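/- Let $(M,g)$ be a connected closed smooth Riemannian manifold of dimension $d\ge 2$, let $T'M=T^*M\setminus\{0\}$, and let $h(y,\eta)=\left(g^{\alpha\beta}(y)\,\eta_\alpha\eta_\beta\right)^{1/2}$ on $T'M$. Let $(x^*(t;y,\eta),\xi^*(t;y,\eta))$, $t\in\mathbb R$, $(y,\eta)\in T'M$, be the Hamiltonian (cogeodesic) flow: the global solution of $\dot x^*=h_\xi(x^*,\xi^*)$, $\dot\xi^*=-h_x(x^*,\xi^*)$ with $(x^*,\xi^*)|_{t=0}=(y,\eta)$. Fix $\epsilon>0$ and let $\varphi(t,x;y,\eta;\epsilon)$ be a Levi-Civita phase function, that is, an infinitely smooth complex-valued function of $(t,x,(y,\eta))\in\mathbb R\times M\times T'M$ with $\operatorname{Im}\varphi\ge0$ such that, for $x$ in a geodesic neighbourhood of $x^*=x^*(t;y,\eta)$, $$\varphi(t,x;y,\eta;\epsilon)=\int_\gamma\zeta\,dz+\frac{i\epsilon}{2}\,h(y,\eta)\,\operatorname{dist}^2(x,x^*),$$ where $\gamma$ is the unique shortest geodesic from $x^*$ to $x$, $\zeta$ is the parallel transport of $\xi^*(t;y,\eta)$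 along $\gamma$ with respect to the Levi-Civita connection, and $\operatorname{dist}$ is the Riemannian distance. (A geodesic neighbourhood of $z$ is the image under $\exp_z$ of an open star-shaped neighbourhood of $0\in T_zM$ on which $\exp_z$ is a diffeomorphism.) Then, in any local coordinates near $x^*$ and any local coordinates near $y$, for all $t\in\mathbb R$ and $(y,\eta)\in T'M$, the coordinates of $x^*$ and the components of $\xi^*$ are differentiable functions of $(\eta_1,\dots,\eta_d)$, and for all $\alpha,\beta\in\{1,\dots,d\}$ $$\varphi_{x^\alpha\eta_\beta}\Big|_{x=x^*}=\frac{\partial\xi^*_\alpha}{\partial\eta_\beta}-\Gamma^\mu{}_{\alpha\nu}(x^*)\,\xi^*_\mu\,\frac{\partial x^{*\nu}}{\partial\eta_\beta}-i\,\epsilon\,h(y,\eta)\,g_{\alpha\nu}(x^*)\,\frac{\partial x^{*\nu}}{\partial\eta_\beta},$$ where $\Gamma^\mu{}_{\alpha\nu}$ are the Christoffel symbols of $g$ and repeated indices are summed from $1$ to $d$. -/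

import Mathlib

open Set Bundle Manifold MeasureTheory
open scoped ContDiff Topology

noncomputable section

namespace LeviCivitaPhase

/-- The coordinate space `ℝᵈ`. -/
abbrev Coord (d : ℕ) : Type := EuclideanSpace ℝ (Fin d)

/-- The partial derivative `∂f/∂uᵅ` of a function of `d` real variables. -/
def pderiv {d : ℕ} {F : Type*} [NormedAddCommGroup F] [NormedSpace ℝ F]
    (f : Coord d → F) (u : Coord d) (α : Fin d) : F :=
  fderiv ℝ f u (EuclideanSpace.single α (1 : ℝ))

section Manifold

variable {d : ℕ} {M : Type*} [MetricSpace M] [ChartedSpace (Coord d) M] [IsManifold (𝓡 d) ∞ M]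

/-- Local coordinates on `M` (charts of the smooth structure). -/
abbrev IsCoordSystem (e : OpenPartialHomeomorph M (Coord d)) : Prop :=
  e ∈ IsManifold.maximalAtlas (𝓡 d) ∞ M

variable (d M) in
/-- The cotangent bundle `T*M`; a point is a pair `⟨y, η⟩` with `η` a linear form on `T_y M`. -/
abbrev Cotangent : Type _ :=
  TotalSpace (Coord d →L[ℝ] ℝ) (fun x : M => TangentSpace (𝓡 d) x →L[ℝ] ℝ)

/-- The coordinate differential `dxᵅ` at `x`. -/
def dCoord (e : OpenPartialHomeomorph M (Coord d)) (x : M) (α : Fin d) :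
    TangentSpace (𝓡 d) x →L[ℝ] ℝ :=
  mfderiv (𝓡 d) 𝓘(ℝ, ℝ) (fun z => e z α) x

/-- The coordinate vector `∂/∂xᵅ` at `x`. -/
def coordVec (e : OpenPartialHomeomorph M (Coord d)) (x : M) (α : Fin d) :
    TangentSpace (𝓡 d) x :=
  (mfderiv (𝓡 d) (𝓡 d) e x).inverse (EuclideanSpace.single α (1 : ℝ) : Coord d)

/-- The covector `∑ q_α dxᵅ` at `x` with components `q`. -/
def covec (e : OpenPartialHomeomorph M (Coord d)) (x : M) (q : Coord d) :
    TangentSpace (𝓡 d) x →L[ℝ] ℝ :=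
  ∑ α, q α • dCoord e x α

/-- The components `ξ_α = ξ(∂/∂xᵅ)` of a covector. -/
def components (e : OpenPartialHomeomorph M (Coord d)) (p : Cotangent d M) : Coord d :=
  WithLp.toLp 2 fun α => p.2 (coordVec e p.1 α)

variable [RiemannianBundle (fun x : M => TangentSpace (𝓡 d) x)]

/-- The matrix `g_{μν}(x)` of the Riemannian metric in the coordinates `e`. -/
def metricMatrix (e : OpenPartialHomeomorph M (Coord d)) (x : M) : Matrix (Fin d) (Fin d) ℝ :=
  Matrix.of fun μ ν => inner ℝ (coordVec e x μ) (coordVec e x ν)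

/-- The partial derivative `∂g_{μν}/∂xˢ` at `x` in the coordinates `e`. -/
def dMetric (e : OpenPartialHomeomorph M (Coord d)) (x : M) (s μ ν : Fin d) : ℝ :=
  pderiv (fun u => metricMatrix e (e.symm u) μ ν) (e x) s

/-- The Christoffel symbol
`Γ^μ_{αν} = ½ g^{μs} (∂_α g_{sν} + ∂_ν g_{sα} - ∂_s g_{αν})` at `x` in the coordinates `e`. -/
def christoffel (e : OpenPartialHomeomorph M (Coord d)) (x : M) (μ α ν : Fin d) : ℝ :=
  (1 / 2) * ∑ s, (metricMatrix e x)⁻¹ μ s *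
    (dMetric e x α s ν + dMetric e x ν s α - dMetric e x s α ν)

/-- The Hamiltonian `h(x, ξ) = (g^{αβ}(x) ξ_α ξ_β)^{1/2}`. The value does not depend on the local
coordinates in which the right-hand side is computed; we take those of the preferred chart
at `x`. -/
def hamiltonian (p : Cotangent d M) : ℝ :=
  Real.sqrt (∑ α, ∑ β, (metricMatrix (chartAt (Coord d) p.1) p.1)⁻¹ α β *
    components (chartAt (Coord d) p.1) p α * components (chartAt (Coord d) p.1) p β)

/-- `Φ t (y, η) = (x*(t; y, η), ξ*(t; y, η))` is the global flow on `T'M = T*M ∖ 0` of Hamilton's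
equations `ẋ* = h_ξ(x*, ξ*)`, `ξ̇* = -h_x(x*, ξ*)` with `(x*, ξ*) = (y, η)` at `t = 0`. The
equations are required in all local coordinates `e`. No regularity in `(y, η)` is required. The
values of `Φ` on the zero section are irrelevant. -/
structure IsHamiltonianFlow (h : Cotangent d M → ℝ)
    (Φ : ℝ → Cotangent d M → Cotangent d M) : Prop where
  initial : ∀ p : Cotangent d M, p.2 ≠ 0 → Φ 0 p = p
  ne_zero : ∀ (t : ℝ) (p : Cotangent d M), p.2 ≠ 0 → (Φ t p).2 ≠ 0
  continuous_base : ∀ p : Cotangent d M, p.2 ≠ 0 → Continuous fun t => (Φ t p).1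
  position : ∀ p : Cotangent d M, p.2 ≠ 0 → ∀ (t : ℝ) (e : OpenPartialHomeomorph M (Coord d)),
    IsCoordSystem e → (Φ t p).1 ∈ e.source → ∀ α : Fin d,
      HasDerivAt (fun s => e (Φ s p).1 α)
        (pderiv (fun q : Coord d => h ⟨(Φ t p).1, covec e (Φ t p).1 q⟩)
          (components e (Φ t p)) α) t
  momentum : ∀ p : Cotangent d M, p.2 ≠ 0 → ∀ (t : ℝ) (e : OpenPartialHomeomorph M (Coord d)),
    IsCoordSystem e → (Φ t p).1 ∈ e.source → ∀ α : Fin d,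
      HasDerivAt (fun s => components e (Φ s p) α)
        (-pderiv (fun u : Coord d =>
          h ⟨e.symm u, covec e (e.symm u) (components e (Φ t p))⟩) (e (Φ t p).1) α) t

/-- `γ : [0, 1] → M` is a geodesic: `γ̈^μ + Γ^μ_{αν}(γ) γ̇^α γ̇^ν = 0` in all local coordinates.
Values of `γ` outside `[0, 1]` are irrelevant. -/
structure IsGeodesic (γ : ℝ → M) : Prop where
  smooth : ContMDiffOn 𝓘(ℝ, ℝ) (𝓡 d) ∞ γ (Icc 0 1)
  equation : ∀ s ∈ Icc (0 : ℝ) 1, ∀ e : OpenPartialHomeomorph M (Coord d),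
    IsCoordSystem e → γ s ∈ e.source → ∀ μ : Fin d,
      derivWithin (fun r => derivWithin (fun τ => e (γ τ) μ) (Icc 0 1) r) (Icc 0 1) s
        + ∑ α, ∑ ν, christoffel e (γ s) μ α ν
            * derivWithin (fun τ => e (γ τ) α) (Icc 0 1) s
            * derivWithin (fun τ => e (γ τ) ν) (Icc 0 1) s = 0

/-- The velocity `γ̇(s)` of a path `γ : [0, 1] → M`. -/
def velocity (γ : ℝ → M) (s : ℝ) : TangentSpace (𝓡 d) (γ s) :=
  mfderivWithin 𝓘(ℝ, ℝ) (𝓡 d) γ (Icc 0 1) s (1 : ℝ)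

/-- `exp_z v = x`: the geodesic with initial point `z` and initial velocity `v` is at `x` at
time `1`. -/
def IsExp (z : M) (v : TangentSpace (𝓡 d) z) (x : M) : Prop :=
  ∃ γ : ℝ → M, IsGeodesic (d := d) γ ∧
    (⟨γ 0, velocity γ 0⟩ : TangentBundle (𝓡 d) M) = ⟨z, v⟩ ∧ γ 1 = x

/-- `U` is a geodesic neighbourhood of `z`: the image under `exp_z` of an open star-shaped
neighbourhood of `0` in `T_z M` on which `exp_z` is a diffeomorphism (onto its open image). -/
def IsGeodesicNhd (z : M) (U : Set M) : Prop :=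
  ∃ E : OpenPartialHomeomorph (TangentSpace (𝓡 d) z) M,
    0 ∈ E.source ∧ StarConvex ℝ 0 E.source ∧ E.target = U ∧
    (∀ v ∈ E.source, IsExp z v (E v)) ∧
    ContMDiffOn 𝓘(ℝ, TangentSpace (𝓡 d) z) (𝓡 d) ∞ E E.source ∧
    ContMDiffOn (𝓡 d) 𝓘(ℝ, TangentSpace (𝓡 d) z) ∞ E.symm E.target

/-- `γ : [0, 1] → M` is a shortest geodesic from `z` to `x`: its length is the Riemannian
distance. -/
structure IsShortestGeodesic (γ : ℝ → M) (z x : M) : Prop where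
  isGeodesic : IsGeodesic (d := d) γ
  start : γ 0 = z
  finish : γ 1 = x
  shortest : pathELength (𝓡 d) γ 0 1 = edist z x

/-- The covectors `ζ s ∈ T*_{γ s} M` are parallel along `γ : [0, 1] → M`:
`ζ̇_α = Γ^μ_{αν}(γ) ζ_μ γ̇^ν` in all local coordinates. -/
def IsParallelAlong (γ : ℝ → M) (ζ : (s : ℝ) → TangentSpace (𝓡 d) (γ s) →L[ℝ] ℝ) : Prop :=
  ∀ s ∈ Icc (0 : ℝ) 1, ∀ e : OpenPartialHomeomorph M (Coord d),
    IsCoordSystem e → γ s ∈ e.source → ∀ α : Fin d,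
      HasDerivWithinAt (fun r => components e ⟨γ r, ζ r⟩ α)
        (∑ μ, ∑ ν, christoffel e (γ s) μ α ν * components e ⟨γ s, ζ s⟩ μ
          * derivWithin (fun τ => e (γ τ) ν) (Icc 0 1) s) (Icc 0 1) s

/-- `φ t x (y, η) = φ(t, x; y, η; ε)` is a Levi-Civita phase function with parameter `ε`, for the
flow `Φ t (y, η) = (x*, ξ*)`: a smooth function on `ℝ × M × T'M` with `Im φ ≥ 0` such that, for
`x` in a geodesic neighbourhood of `x*`,
`φ = ∫_γ ζ dz + (i ε / 2) h(y, η) dist²(x, x*)`, where `γ` is the unique shortest geodesic from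
`x*` to `x` and `ζ` is the parallel transport of `ξ*` along `γ`. -/
structure IsLeviCivitaPhase (ε : ℝ) (Φ : ℝ → Cotangent d M → Cotangent d M)
    (φ : ℝ → M → Cotangent d M → ℂ) : Prop where
  smooth : ContMDiffOn
    (𝓘(ℝ, ℝ).prod ((𝓡 d).prod ((𝓡 d).prod 𝓘(ℝ, Coord d →L[ℝ] ℝ)))) 𝓘(ℝ, ℂ) ∞
    (fun q : ℝ × M × Cotangent d M => φ q.1 q.2.1 q.2.2) {q | q.2.2.2 ≠ 0}
  im_nonneg : ∀ (t : ℝ) (x : M) (p : Cotangent d M), p.2 ≠ 0 → 0 ≤ (φ t x p).im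
  formula : ∀ (t : ℝ) (p : Cotangent d M), p.2 ≠ 0 →
    ∃ U : Set M, IsGeodesicNhd (d := d) (Φ t p).1 U ∧ ∀ x ∈ U,
      ∃ (γ : ℝ → M) (ζ : (s : ℝ) → TangentSpace (𝓡 d) (γ s) →L[ℝ] ℝ),
        IsShortestGeodesic (d := d) γ (Φ t p).1 x ∧
        (∀ γ' : ℝ → M, IsShortestGeodesic (d := d) γ' (Φ t p).1 x → EqOn γ' γ (Icc 0 1)) ∧
        IsParallelAlong γ ζ ∧
        (⟨γ 0, ζ 0⟩ : Cotangent d M) = Φ t p ∧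
        φ t x p = ((∫ s in (0 : ℝ)..1, ζ s (velocity γ s) : ℝ) : ℂ)
          + Complex.I * (ε : ℂ) / 2 * (hamiltonian p : ℂ) * ((dist x (Φ t p).1 : ℝ) : ℂ) ^ 2

/-! The flow and the phase function in local coordinates `ex` for `x` and `ey` for `y`, with `t` and
`y` fixed, as functions of the components `q` of the covector at `y` (and of the coordinates `u`
of `x`). -/

/-- The coordinates of `x*(t; y, η)` as functions of the components `q` of `η`. -/
def xStar (Φ : ℝ → Cotangent d M → Cotangent d M) (ex ey : OpenPartialHomeomorph M (Coord d))
    (t : ℝ) (y : M) (q : Coord d) : Coord d :=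
  ex (Φ t ⟨y, covec ey y q⟩).1

/-- The components of `ξ*(t; y, η)` as functions of the components `q` of `η`. -/
def xiStar (Φ : ℝ → Cotangent d M → Cotangent d M) (ex ey : OpenPartialHomeomorph M (Coord d))
    (t : ℝ) (y : M) (q : Coord d) : Coord d :=
  components ex (Φ t ⟨y, covec ey y q⟩)

/-- `φ(t, x; y, η)` as a function of the coordinates `u` of `x` and the components `q` of `η`. -/
def phaseInCoords (φ : ℝ → M → Cotangent d M → ℂ) (ex ey : OpenPartialHomeomorph M (Coord d))
    (t : ℝ) (y : M) (u q : Coord d) : ℂ :=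
  φ t (ex.symm u) ⟨y, covec ey y q⟩

/-- The mixed second derivative `φ_{x^α η_β}` at the point with coordinates `u` and `q`. -/
def mixedHessian (φ : ℝ → M → Cotangent d M → ℂ) (ex ey : OpenPartialHomeomorph M (Coord d))
    (t : ℝ) (y : M) (u q : Coord d) (α β : Fin d) : ℂ :=
  pderiv (fun q' => pderiv (fun u' => phaseInCoords φ ex ey t y u' q') u α) q β

end Manifold

end LeviCivitaPhase

end

open LeviCivitaPhase

noncomputable section

set_option linter.unusedSectionVars false

namespace LeviCivitaPhase

/-! ### Components of vectors and covectors, and the metric matrix -/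

section

variable {d : ℕ} {M : Type*} [MetricSpace M] [ChartedSpace (Coord d) M] [IsManifold (𝓡 d) ∞ M]
  {e : OpenPartialHomeomorph M (Coord d)} {x : M}

/-! No regularity of the flow in `η` is assumed, so it has to be extracted from the smoothness of
`φ`. The proof determines the 2-jet of `φ` in `x` at `x*`, uses it to recover `x*` and `ξ*`
differentiably from `φ`, and then applies the chain rule.

2-jet. Along a geodesic, the pairing of a parallel covector with the velocity is constant, and so is
the speed. An initial segment of a shortest geodesic, reparametrised to `[0, 1]`, is again shortest.
Hence for a shortest geodesic `γ` from `x*` with initial velocity `V`, and small `s ≥ 0`, `φ(γ(s)) =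
s ξ*(V) + s² (iε/2) h g(V, V)`. Two differentiations at `s = 0`, with `γ̈ = -Γ(V, V)`, give `φ_x(V)
= ξ*(V)` and `φ_xx(V, V) = Γ^μ_{αν} ξ*_μ V^α V^ν + iεh g(V, V)`. Both identities are closed
conditions, stable under positive scaling of `V`. By `mem_cone_of_initial_velocities` the directions
of shortest geodesics are dense, so they hold for all `V`; symmetry and polarization give the full
Hessian (`fderiv_xStar`, `fderiv_fderiv_xStar`).

Regularity. Since `ξ*` is real and `Im φ_xx = εh g` is positive definite, `x*` is a nondegenerate
critical point of `Im φ` in `x`. The implicit function theorem represents `x*` as a differentiable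
function of `(t, η)`, provided the trajectory is known to stay near the reference one. That is a
connectedness argument in `t`, starting from `x* = y` at `t = 0` (`exists_local_description`,
`continuousAt_flow`).

Formula. The identity `φ_x(t, x*(η); η) = ξ*(η)` now makes `ξ*` differentiable, and its
`η`-derivative reads `φ_xη + φ_xx x*_η = ξ*_η`. Inserting `φ_xx` proves the theorem. -/

lemma Coord.sum_single (v : Coord d) :
    v = ∑ α, v α • (EuclideanSpace.single α (1 : ℝ) : Coord d) := by
  ext β
  simp [Finset.sum_apply, Pi.single_apply]

lemma IsCoordSystem.mdifferentiable (he : IsCoordSystem e) : e.MDifferentiable (𝓡 d) (𝓡 d) := by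
  have h1 : e ∈ IsManifold.maximalAtlas (𝓡 d) 1 M :=
    IsManifold.maximalAtlas_subset_of_le (by simp) he
  exact ⟨fun x hx => (mdifferentiableAt_of_mem_maximalAtlas h1 hx).mdifferentiableWithinAt,
    fun x hx => (mdifferentiableAt_symm_of_mem_maximalAtlas h1 hx).mdifferentiableWithinAt⟩

lemma IsCoordSystem.contMDiffAt (he : IsCoordSystem e) (hx : x ∈ e.source) :
    ContMDiffAt (𝓡 d) (𝓡 d) ∞ e x :=
  contMDiffAt_of_mem_maximalAtlas he hx

lemma IsCoordSystem.contMDiffAt_symm (he : IsCoordSystem e) {u : Coord d} (hu : u ∈ e.target) :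
    ContMDiffAt (𝓡 d) (𝓡 d) ∞ e.symm u :=
  contMDiffAt_symm_of_mem_maximalAtlas he hu

/-- Inside the source the chart derivative is invertible, so `ContinuousLinearMap.inverse` in
`coordVec` is the true inverse and not its default value `0`. -/
lemma inverse_mfderiv (he : IsCoordSystem e) (hx : x ∈ e.source) :
    (mfderiv (𝓡 d) (𝓡 d) e x).inverse = mfderiv (𝓡 d) (𝓡 d) e.symm (e x) := by
  have h1 := he.mdifferentiable.symm_comp_deriv hx
  have h2 := he.mdifferentiable.comp_symm_deriv (e.map_source hx)
  rw [e.left_inv hx] at h2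
  apply ContinuousLinearMap.inverse_eq h2 h1

/-- The components of a tangent vector in local coordinates. -/
def vecComponents (e : OpenPartialHomeomorph M (Coord d)) (x : M) :
    TangentSpace (𝓡 d) x →L[ℝ] Coord d :=
  mfderiv (𝓡 d) (𝓡 d) e x

/-- The tangent vector with given components in local coordinates. -/
def vecOfComponents (e : OpenPartialHomeomorph M (Coord d)) (x : M) :
    Coord d →L[ℝ] TangentSpace (𝓡 d) x :=
  (mfderiv (𝓡 d) (𝓡 d) e x).inverse

lemma vecOfComponents_single (e : OpenPartialHomeomorph M (Coord d)) (x : M) (α : Fin d) :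
    vecOfComponents e x (EuclideanSpace.single α (1 : ℝ)) = coordVec e x α := rfl

lemma vecOfComponents_vecComponents (he : IsCoordSystem e) (hx : x ∈ e.source)
    (v : TangentSpace (𝓡 d) x) : vecOfComponents e x (vecComponents e x v) = v := by
  have h := he.mdifferentiable.symm_comp_deriv hx
  rw [← inverse_mfderiv he hx] at h
  exact DFunLike.congr_fun h v

lemma vecComponents_vecOfComponents (he : IsCoordSystem e) (hx : x ∈ e.source) (v : Coord d) :
    vecComponents e x (vecOfComponents e x v) = v := by
  have h := he.mdifferentiable.comp_symm_deriv (e.map_source hx)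
  rw [e.left_inv hx, ← inverse_mfderiv he hx] at h
  exact DFunLike.congr_fun h v

lemma coordVec_eq (he : IsCoordSystem e) (hx : x ∈ e.source) (α : Fin d) :
    coordVec e x α =
      mfderiv (𝓡 d) (𝓡 d) e.symm (e x) (EuclideanSpace.single α (1 : ℝ) : Coord d) := by
  rw [coordVec, inverse_mfderiv he hx]
  rfl

lemma eq_sum_coordVec (he : IsCoordSystem e) (hx : x ∈ e.source) (v : TangentSpace (𝓡 d) x) :
    v = ∑ α, vecComponents e x v α • coordVec e x α := by
  conv_lhs => rw [← vecOfComponents_vecComponents he hx v,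
    Coord.sum_single (vecComponents e x v), map_sum]
  simp_rw [map_smul, vecOfComponents_single]

lemma vecComponents_coordVec (he : IsCoordSystem e) (hx : x ∈ e.source) (α : Fin d) :
    vecComponents e x (coordVec e x α) = EuclideanSpace.single α (1 : ℝ) :=
  vecComponents_vecOfComponents he hx _

lemma dCoord_apply (he : IsCoordSystem e) (hx : x ∈ e.source) (α : Fin d)
    (v : TangentSpace (𝓡 d) x) : dCoord e x α v = vecComponents e x v α := by
  have h1 : HasMFDerivAt (𝓡 d) 𝓘(ℝ, ℝ) (EuclideanSpace.proj (𝕜 := ℝ) α : Coord d →L[ℝ] ℝ) (e x)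
      (EuclideanSpace.proj (𝕜 := ℝ) α : Coord d →L[ℝ] ℝ) :=
    (EuclideanSpace.proj (𝕜 := ℝ) α : Coord d →L[ℝ] ℝ).hasFDerivAt.hasMFDerivAt
  have h2 := (he.mdifferentiable.mdifferentiableAt hx).hasMFDerivAt
  have h3 := (h1.comp x h2).mfderiv
  have : dCoord e x α = _ := h3
  rw [this]
  rfl

lemma covec_apply (he : IsCoordSystem e) (hx : x ∈ e.source) (q : Coord d)
    (v : TangentSpace (𝓡 d) x) : covec e x q v = ∑ α, q α * vecComponents e x v α := by
  simp only [covec, sum_apply, smul_apply, smul_eq_mul]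
  simp_rw [dCoord_apply he hx]

lemma covec_ne_zero (he : IsCoordSystem e) (hx : x ∈ e.source) {q : Coord d} (hq : q ≠ 0) :
    covec e x q ≠ 0 := by
  intro h
  apply hq
  ext α
  have := covec_apply he hx q (coordVec e x α)
  rw [h, vecComponents_coordVec he hx] at this
  simpa [Pi.single_apply] using this.symm

lemma pairing_eq_sum (he : IsCoordSystem e) (p : Cotangent d M) (hx : p.1 ∈ e.source)
    (v : TangentSpace (𝓡 d) p.1) :
    p.2 v = ∑ α, components e p α * vecComponents e p.1 v α := by
  conv_lhs => rw [eq_sum_coordVec he hx v]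
  simp [components, mul_comm]

variable [RiemannianBundle (fun x : M => TangentSpace (𝓡 d) x)]

lemma inner_eq_sum (he : IsCoordSystem e) (hx : x ∈ e.source) (v w : TangentSpace (𝓡 d) x) :
    inner ℝ v w = ∑ α, ∑ β, metricMatrix e x α β * vecComponents e x v α * vecComponents e x w β := by
  conv_lhs => rw [eq_sum_coordVec he hx v, eq_sum_coordVec he hx w]
  simp only [sum_inner, metricMatrix, Matrix.of_apply, inner_sum]
  rw [Finset.sum_comm]
  refine Finset.sum_congr rfl fun α _ => Finset.sum_congr rfl fun β _ => ?_
  rw [real_inner_smul_left, real_inner_smul_right]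
  ring

lemma metricMatrix_comm (x : M) (α β : Fin d) : metricMatrix e x α β = metricMatrix e x β α := by
  simp only [metricMatrix, Matrix.of_apply]
  exact real_inner_comm _ _

lemma metricMatrix_posDef (he : IsCoordSystem e) (hx : x ∈ e.source) :
    (metricMatrix e x).PosDef := by
  refine Matrix.PosDef.of_dotProduct_mulVec_pos ?_ ?_
  · ext α β
    simp [metricMatrix_comm x α β]
  · intro v hv
    let w : Coord d := WithLp.toLp 2 v
    have hw := vecComponents_vecOfComponents he hx w
    have h0 : vecOfComponents e x w ≠ 0 := by
      intro h
      rw [h, map_zero] at hw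
      exact hv (congrArg WithLp.ofLp hw.symm)
    have h1 := real_inner_self_pos.2 h0
    rw [inner_eq_sum he hx, hw] at h1
    simp only [dotProduct, Matrix.mulVec, Finset.mul_sum, star_trivial]
    refine h1.trans_eq (Finset.sum_congr rfl fun α _ => Finset.sum_congr rfl fun β _ => ?_)
    simp only [w]
    ring

/-- The inverse of a positive definite matrix is positive definite. Positivity of `h` is what makes
`Im φ_xx` definite at `x*`. -/
lemma hamiltonian_pos {p : Cotangent d M} (hp : p.2 ≠ 0) : 0 < hamiltonian p := by
  have hc : IsCoordSystem (chartAt (Coord d) p.1) := IsManifold.chart_mem_maximalAtlas p.1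
  have hm := mem_chart_source (Coord d) p.1
  have hpos := (metricMatrix_posDef hc hm).inv
  have hne : (components (chartAt (Coord d) p.1) p).ofLp ≠ 0 := by
    intro h
    apply hp
    ext v
    rw [pairing_eq_sum hc p hm v]
    simp [h]
  have := hpos.dotProduct_mulVec_pos hne
  rw [hamiltonian, Real.sqrt_pos]
  simp only [dotProduct, Matrix.mulVec, Finset.mul_sum, star_trivial] at this
  refine this.trans_eq (Finset.sum_congr rfl fun α _ => Finset.sum_congr rfl fun β _ => ?_)
  ring

section Smooth

variable [IsContMDiffRiemannianBundle (𝓡 d) ∞ (Coord d) (fun x : M => TangentSpace (𝓡 d) x)]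

/-- The coordinate fields are the images of constant fields under the tangent map of `e.symm`, hence
smooth, and the metric pairs smooth fields smoothly. -/
lemma contDiffOn_metricMatrix (he : IsCoordSystem e) (α β : Fin d) :
    ContDiffOn ℝ ∞ (fun u => metricMatrix e (e.symm u) α β) e.target := by
  have key : ∀ γ : Fin d, ContMDiffOn (𝓡 d) ((𝓡 d).prod (𝓡 d)) ∞
      (fun u : Coord d => (⟨e.symm u, coordVec e (e.symm u) γ⟩ : TangentBundle (𝓡 d) M))
      e.target := by
    intro γ
    have h1 : ContMDiffOn (𝓡 d) (𝓡 d) ∞ e.symm e.target := fun u hu =>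
      (he.contMDiffAt_symm hu).contMDiffWithinAt
    have h2 := h1.contMDiffOn_tangentMapWithin (m := ∞) (by simp)
      e.open_target.uniqueMDiffOn
    have h3 : ContMDiff (𝓡 d) ((𝓡 d).prod (𝓡 d)) ∞
        (fun u : Coord d => (⟨u, (EuclideanSpace.single γ (1 : ℝ) : Coord d)⟩ :
          TangentBundle (𝓡 d) (Coord d))) := by
      intro u
      exact contMDiffAt_vectorSpace_iff_contDiffAt.2 contDiffAt_const
    refine (h2.comp h3.contMDiffOn (s := e.target) (fun u hu => hu)).congr fun u hu => ?_
    simp only [Function.comp, tangentMapWithin]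
    congr 1
    rw [mfderivWithin_of_isOpen e.open_target hu, coordVec_eq he (e.map_target hu),
      e.right_inv hu]
  exact ((key α).inner_bundle (key β)).contDiffOn

end Smooth

end

/-! ### Paths, Christoffel symbols and the geodesic equation in coordinates -/

section

variable {d : ℕ} {M : Type*} [MetricSpace M] [ChartedSpace (Coord d) M] [IsManifold (𝓡 d) ∞ M]
  {e : OpenPartialHomeomorph M (Coord d)} {x : M}

section Paths

variable {γ : ℝ → M} {s : ℝ}

lemma contDiffWithinAt_coord (hγ : ContMDiffOn 𝓘(ℝ, ℝ) (𝓡 d) ∞ γ (Icc 0 1))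
    (hs : s ∈ Icc (0 : ℝ) 1) (he : IsCoordSystem e) (hx : γ s ∈ e.source) :
    ContDiffWithinAt ℝ ∞ (fun r => e (γ r)) (Icc 0 1) s :=
  ((he.contMDiffAt hx).comp_contMDiffWithinAt s (hγ s hs)).contDiffWithinAt

lemma hasDerivWithinAt_coord (hγ : ContMDiffOn 𝓘(ℝ, ℝ) (𝓡 d) ∞ γ (Icc 0 1))
    (hs : s ∈ Icc (0 : ℝ) 1) (he : IsCoordSystem e) (hx : γ s ∈ e.source) :
    HasDerivWithinAt (fun r => e (γ r)) (derivWithin (fun r => e (γ r)) (Icc 0 1) s)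
      (Icc 0 1) s :=
  ((contDiffWithinAt_coord hγ hs he hx).differentiableWithinAt (by simp)).hasDerivWithinAt

lemma derivWithin_coord_apply (hγ : ContMDiffOn 𝓘(ℝ, ℝ) (𝓡 d) ∞ γ (Icc 0 1))
    (hs : s ∈ Icc (0 : ℝ) 1) (he : IsCoordSystem e) (hx : γ s ∈ e.source) (μ : Fin d) :
    derivWithin (fun r => e (γ r) μ) (Icc 0 1) s =
      derivWithin (fun r => e (γ r)) (Icc 0 1) s μ :=
  ((EuclideanSpace.proj (𝕜 := ℝ) μ : Coord d →L[ℝ] ℝ).hasFDerivAt.comp_hasDerivWithinAt s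
    (hasDerivWithinAt_coord hγ hs he hx)).derivWithin (uniqueDiffOn_Icc zero_lt_one s hs)

lemma eventually_mem_source (hγ : ContinuousOn γ (Icc 0 1)) (hs : s ∈ Icc (0 : ℝ) 1)
    (hx : γ s ∈ e.source) : ∀ᶠ r in 𝓝[Icc 0 1] s, r ∈ Icc (0 : ℝ) 1 ∧ γ r ∈ e.source :=
  eventually_mem_nhdsWithin.and ((hγ s hs).eventually (e.open_source.mem_nhds hx))

lemma hasDerivWithinAt_velocity (hγ : ContMDiffOn 𝓘(ℝ, ℝ) (𝓡 d) ∞ γ (Icc 0 1))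
    (hs : s ∈ Icc (0 : ℝ) 1) (he : IsCoordSystem e) (hx : γ s ∈ e.source) :
    HasDerivWithinAt (fun r => derivWithin (fun τ => e (γ τ)) (Icc 0 1) r)
      (derivWithin (fun r => derivWithin (fun τ => e (γ τ)) (Icc 0 1) r) (Icc 0 1) s)
      (Icc 0 1) s := by
  have h1 := (contDiffWithinAt_coord hγ hs he hx).fderivWithin_right (m := 1)
    (uniqueDiffOn_Icc zero_lt_one) (by norm_cast) hs
  have h2 : DifferentiableWithinAt ℝ (fun r => derivWithin (fun τ => e (γ τ)) (Icc 0 1) r)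
      (Icc 0 1) s :=
    (h1.differentiableWithinAt one_ne_zero).clm_apply (differentiableWithinAt_const (1 : ℝ))
  exact h2.hasDerivWithinAt

lemma vecComponents_velocity (hγ : ContMDiffOn 𝓘(ℝ, ℝ) (𝓡 d) ∞ γ (Icc 0 1))
    (hs : s ∈ Icc (0 : ℝ) 1) (he : IsCoordSystem e) (hx : γ s ∈ e.source) :
    vecComponents e (γ s) (velocity γ s) = derivWithin (fun r => e (γ r)) (Icc 0 1) s := by
  have h1 := (he.mdifferentiable.mdifferentiableAt hx).hasMFDerivAt
  have h2 := ((hγ s hs).mdifferentiableWithinAt (by simp)).hasMFDerivWithinAt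
  obtain ⟨L, hL, hL1⟩ : ∃ L : ℝ →L[ℝ] Coord d, HasFDerivWithinAt (fun r => e (γ r)) L (Icc 0 1) s ∧
      L 1 = vecComponents e (γ s) (velocity γ s) :=
    ⟨_, (h1.comp_hasMFDerivWithinAt s h2).hasFDerivWithinAt, rfl⟩
  rw [← hL1]
  exact (hL.hasDerivWithinAt.derivWithin (uniqueDiffOn_Icc zero_lt_one s hs)).symm

end Paths

variable [RiemannianBundle (fun x : M => TangentSpace (𝓡 d) x)]

lemma dMetric_comm (x : M) (s μ ν : Fin d) : dMetric e x s μ ν = dMetric e x s ν μ := by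
  unfold dMetric
  simp_rw [metricMatrix_comm _ μ ν]

lemma christoffel_comm (x : M) (μ α ν : Fin d) : christoffel e x μ α ν = christoffel e x μ ν α := by
  unfold christoffel
  congr 1
  refine Finset.sum_congr rfl fun s _ => ?_
  rw [dMetric_comm x s α ν]
  ring

/-- Lowering the index cancels the inverse metric and leaves the Christoffel symbol of the first
kind. -/
lemma sum_metricMatrix_mul_christoffel (he : IsCoordSystem e) (hx : x ∈ e.source)
    (l α ν : Fin d) :
    ∑ μ, metricMatrix e x l μ * christoffel e x μ α ν =
      (1 / 2) * (dMetric e x α l ν + dMetric e x ν l α - dMetric e x l α ν) := by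
  have h : metricMatrix e x * (metricMatrix e x)⁻¹ = 1 :=
    Matrix.mul_nonsing_inv _ (metricMatrix_posDef he hx).det_pos.ne'.isUnit
  have h1 : ∀ s, ∑ μ, metricMatrix e x l μ * (metricMatrix e x)⁻¹ μ s = if l = s then 1 else 0 := by
    intro s
    rw [← Matrix.mul_apply, h, Matrix.one_apply]
  unfold christoffel
  simp_rw [Finset.mul_sum]
  rw [Finset.sum_comm]
  have h2 : ∀ s, ∑ μ, metricMatrix e x l μ * (1 / 2 * ((metricMatrix e x)⁻¹ μ s *
      (dMetric e x α s ν + dMetric e x ν s α - dMetric e x s α ν))) =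
      (if l = s then 1 else 0) *
        (1 / 2 * (dMetric e x α s ν + dMetric e x ν s α - dMetric e x s α ν)) := by
    intro s
    rw [← h1, Finset.sum_mul]
    exact Finset.sum_congr rfl fun μ _ => by ring
  simp_rw [h2]
  simp

section Smooth

variable [IsContMDiffRiemannianBundle (𝓡 d) ∞ (Coord d) (fun x : M => TangentSpace (𝓡 d) x)]

lemma continuousOn_christoffel (he : IsCoordSystem e) (μ α ν : Fin d) :
    ContinuousOn (fun u => christoffel e (e.symm u) μ α ν) e.target := by
  have hd : ∀ s α β, ContinuousOn (fun u => dMetric e (e.symm u) s α β) e.target := by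
    intro s α β
    have h := ((contDiffOn_metricMatrix he α β).continuousOn_fderiv_of_isOpen e.open_target
      (by simp)).clm_apply (continuousOn_const (c := (EuclideanSpace.single s (1 : ℝ) : Coord d)))
    refine h.congr fun u hu => ?_
    simp only [dMetric, pderiv, e.right_inv hu]
  have hg : ContinuousOn (fun u => metricMatrix e (e.symm u)) e.target :=
    continuousOn_pi.2 fun α => continuousOn_pi.2 fun β => (contDiffOn_metricMatrix he α β).continuousOn
  have hi : ContinuousOn (fun u => (metricMatrix e (e.symm u))⁻¹) e.target := by
    intro u hu
    have h1 : ContinuousAt Inv.inv (metricMatrix e (e.symm u)) := by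
      apply continuousAt_matrix_inv
      rw [Ring.inverse_eq_inv']
      exact continuousAt_inv₀ (metricMatrix_posDef he (e.map_target hu)).det_pos.ne'
    exact ContinuousAt.comp_continuousWithinAt (f := fun u => metricMatrix e (e.symm u)) h1 (hg u hu)
  have hi' : ∀ α β, ContinuousOn (fun u => (metricMatrix e (e.symm u))⁻¹ α β) e.target :=
    fun α β => continuousOn_pi.1 (continuousOn_pi.1 hi α) β
  unfold christoffel
  exact continuousOn_const.mul (continuousOn_finsetSum _ fun s _ =>
    (hi' μ s).mul (((hd α s ν).add (hd ν s α)).sub (hd s α ν)))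

variable {γ : ℝ → M} {s : ℝ}

lemma hasDerivWithinAt_metricMatrix (hγ : ContMDiffOn 𝓘(ℝ, ℝ) (𝓡 d) ∞ γ (Icc 0 1))
    (hs : s ∈ Icc (0 : ℝ) 1) (he : IsCoordSystem e) (hx : γ s ∈ e.source) (α β : Fin d) :
    HasDerivWithinAt (fun r => metricMatrix e (γ r) α β)
      (∑ σ, dMetric e (γ s) σ α β * derivWithin (fun r => e (γ r)) (Icc 0 1) s σ)
      (Icc 0 1) s := by
  have hu := e.map_source hx
  have h1 : DifferentiableAt ℝ (fun u => metricMatrix e (e.symm u) α β) (e (γ s)) :=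
    ((contDiffOn_metricMatrix he α β).contDiffAt (e.open_target.mem_nhds hu)).differentiableAt
      (by simp)
  have h2 := h1.hasFDerivAt.comp_hasDerivWithinAt s (hasDerivWithinAt_coord hγ hs he hx)
  rw [Coord.sum_single (derivWithin (fun r => e (γ r)) (Icc 0 1) s), map_sum] at h2
  simp_rw [map_smul] at h2
  have h3 : HasDerivWithinAt (fun r => metricMatrix e (γ r) α β)
      (∑ σ, derivWithin (fun r => e (γ r)) (Icc 0 1) s σ • dMetric e (γ s) σ α β) (Icc 0 1) s := by
    refine h2.congr_of_eventuallyEq ?_ ?_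
    · filter_upwards [eventually_mem_source hγ.continuousOn hs hx] with r hr
      simp [e.left_inv hr.2]
    · simp [e.left_inv hx]
  refine h3.congr_deriv (Finset.sum_congr rfl fun σ _ => ?_)
  rw [smul_eq_mul, mul_comm]

/-- The right-hand side of the geodesic equation, solved for the second derivative. -/
def geodesicAccel (e : OpenPartialHomeomorph M (Coord d)) (x : M) (V : Coord d) : Coord d :=
  WithLp.toLp 2 fun μ => -∑ α, ∑ ν, christoffel e x μ α ν * V α * V ν

lemma IsGeodesic.hasDerivWithinAt (hγ : IsGeodesic (d := d) γ)
    (hs : s ∈ Icc (0 : ℝ) 1) (he : IsCoordSystem e) (hx : γ s ∈ e.source) :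
    HasDerivWithinAt (fun r => derivWithin (fun τ => e (γ τ)) (Icc 0 1) r)
      (geodesicAccel e (γ s) (derivWithin (fun τ => e (γ τ)) (Icc 0 1) s)) (Icc 0 1) s := by
  have h := hasDerivWithinAt_velocity hγ.smooth hs he hx
  refine h.congr_deriv ?_
  ext μ
  have h1 := hγ.equation s hs e he hx μ
  have h2 : derivWithin (fun r => derivWithin (fun τ => e (γ τ) μ) (Icc 0 1) r) (Icc 0 1) s =
      derivWithin (fun r => derivWithin (fun τ => e (γ τ)) (Icc 0 1) r) (Icc 0 1) s μ := by
    have h3 := (EuclideanSpace.proj (𝕜 := ℝ) μ : Coord d →L[ℝ] ℝ).hasFDerivAt.comp_hasDerivWithinAt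
      s h
    refine HasDerivWithinAt.derivWithin ?_ (uniqueDiffOn_Icc zero_lt_one s hs)
    refine h3.congr_of_eventuallyEq ?_ ?_
    · filter_upwards [eventually_mem_source hγ.smooth.continuousOn hs hx] with r hr
      exact derivWithin_coord_apply hγ.smooth hr.1 he hr.2 μ
    · exact derivWithin_coord_apply hγ.smooth hs he hx μ
  rw [h2] at h1
  simp_rw [derivWithin_coord_apply hγ.smooth hs he hx] at h1
  simp only [geodesicAccel]
  linarith

/-- Contracted with `V` three times, the three metric derivatives in the Christoffel symbol have
equal sums, with signs `+`, `+`, `-`, so one survives. This is the identity behind conservation of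
speed. -/
lemma sum_metric_geodesicAccel (he : IsCoordSystem e) (hx : x ∈ e.source) (V : Coord d) :
    ∑ α, ∑ β, metricMatrix e x α β * V α * geodesicAccel e x V β =
      -(1 / 2) * ∑ α, ∑ β, ∑ σ, dMetric e x σ α β * V σ * V α * V β := by
  have h1 : ∀ α, ∑ β, metricMatrix e x α β * V α * geodesicAccel e x V β =
      -∑ σ, ∑ ν, (∑ β, metricMatrix e x α β * christoffel e x β σ ν) * (V α * V σ * V ν) := by
    intro α
    simp only [geodesicAccel, mul_neg, Finset.sum_neg_distrib, Finset.mul_sum, Finset.sum_mul]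
    rw [Finset.sum_comm]
    congr 1
    refine Finset.sum_congr rfl fun σ _ => ?_
    rw [Finset.sum_comm]
    exact Finset.sum_congr rfl fun ν _ => Finset.sum_congr rfl fun β _ => by ring
  simp_rw [h1, sum_metricMatrix_mul_christoffel he hx]
  set T : Fin d → Fin d → Fin d → ℝ := fun σ α β => dMetric e x σ α β * V σ * V α * V β with hT
  have e1 : ∀ α σ ν, 1 / 2 * (dMetric e x σ α ν + dMetric e x ν α σ - dMetric e x α σ ν) *
      (V α * V σ * V ν) = 1 / 2 * (T σ α ν + T ν α σ - T α σ ν) := by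
    intro α σ ν
    simp only [hT]
    ring
  have s1 : ∑ α, ∑ σ, ∑ ν, T σ α ν = ∑ α, ∑ σ, ∑ ν, T α σ ν := Finset.sum_comm
  have s2 : ∑ α, ∑ σ, ∑ ν, T ν α σ = ∑ α, ∑ σ, ∑ ν, T α σ ν := by
    rw [Finset.sum_comm]
    simp_rw [fun σ => Finset.sum_comm (f := fun α ν => T ν α σ) (s := Finset.univ) (t := Finset.univ)]
    rw [Finset.sum_comm]
    refine Finset.sum_congr rfl fun α _ => ?_
    rw [Finset.sum_comm]
  have s3 : ∑ α, ∑ β, ∑ σ, dMetric e x σ α β * V σ * V α * V β = ∑ α, ∑ σ, ∑ ν, T α σ ν := s2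
  rw [s3]
  simp_rw [e1, ← Finset.mul_sum, Finset.sum_sub_distrib, Finset.sum_add_distrib]
  rw [Finset.sum_neg_distrib, ← Finset.mul_sum]
  simp_rw [Finset.sum_sub_distrib, Finset.sum_add_distrib]
  rw [s1, s2]
  ring

end Smooth

end

/-! ### Conserved quantities and reparametrisation of geodesics -/

section

variable {d : ℕ} {M : Type*} [MetricSpace M] [ChartedSpace (Coord d) M] [IsManifold (𝓡 d) ∞ M]
  [RiemannianBundle (fun x : M => TangentSpace (𝓡 d) x)]
  [IsContMDiffRiemannianBundle (𝓡 d) ∞ (Coord d) (fun x : M => TangentSpace (𝓡 d) x)]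
  {e : OpenPartialHomeomorph M (Coord d)} {x : M} {γ : ℝ → M} {s : ℝ}

lemma eq_of_hasDerivWithinAt_zero {f : ℝ → ℝ}
    (h : ∀ s ∈ Icc (0 : ℝ) 1, HasDerivWithinAt f 0 (Icc 0 1) s) (hs : s ∈ Icc (0 : ℝ) 1) :
    f s = f 0 :=
  constant_of_derivWithin_zero (fun r hr => (h r hr).differentiableWithinAt)
    (fun r hr => (h r (Ico_subset_Icc_self hr)).derivWithin
      (uniqueDiffOn_Icc zero_lt_one r (Ico_subset_Icc_self hr))) s hs

lemma inner_velocity_eq_sum (hγ : ContMDiffOn 𝓘(ℝ, ℝ) (𝓡 d) ∞ γ (Icc 0 1))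
    (hs : s ∈ Icc (0 : ℝ) 1) (he : IsCoordSystem e) (hx : γ s ∈ e.source) :
    inner ℝ (velocity (d := d) γ s) (velocity (d := d) γ s) = ∑ α, ∑ β, metricMatrix e (γ s) α β *
      derivWithin (fun r => e (γ r)) (Icc 0 1) s α *
      derivWithin (fun r => e (γ r)) (Icc 0 1) s β := by
  rw [inner_eq_sum he hx, vecComponents_velocity hγ hs he hx]

lemma hasDerivWithinAt_apply {k : ℝ → Coord d} {k' : Coord d} {S : Set ℝ}
    (h : HasDerivWithinAt k k' S s) (α : Fin d) :
    HasDerivWithinAt (fun r => k r α) (k' α) S s :=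
  (EuclideanSpace.proj (𝕜 := ℝ) α : Coord d →L[ℝ] ℝ).hasFDerivAt.comp_hasDerivWithinAt s h

/-- Geodesics have constant speed. -/
lemma IsGeodesic.norm_velocity (hγ : IsGeodesic (d := d) γ) (hs : s ∈ Icc (0 : ℝ) 1) :
    ‖velocity (d := d) γ s‖ = ‖velocity (d := d) γ 0‖ := by
  have key := eq_of_hasDerivWithinAt_zero (s := s)
    (f := fun r => inner ℝ (velocity (d := d) γ r) (velocity (d := d) γ r)) ?_ hs
  · simp only [real_inner_self_eq_norm_sq] at key
    exact (sq_eq_sq₀ (norm_nonneg _) (norm_nonneg _)).1 key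
  intro r hr
  set e := chartAt (Coord d) (γ r)
  have he : IsCoordSystem e := IsManifold.chart_mem_maximalAtlas _
  have hx : γ r ∈ e.source := mem_chart_source _ _
  set V := fun r => derivWithin (fun τ => e (γ τ)) (Icc 0 1) r with hV
  set A := geodesicAccel e (γ r) (V r) with hA
  have hD : HasDerivWithinAt V A (Icc 0 1) r := hγ.hasDerivWithinAt hr he hx
  have hg := fun α β => hasDerivWithinAt_metricMatrix hγ.smooth hr he hx α β
  have h := HasDerivWithinAt.fun_sum (u := Finset.univ) fun α _ =>
    HasDerivWithinAt.fun_sum (u := Finset.univ) fun β _ =>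
    ((hg α β).mul (hasDerivWithinAt_apply hD α)).mul (hasDerivWithinAt_apply hD β)
  have h' := h.congr_of_eventuallyEq (f₁ := fun r => inner ℝ (velocity (d := d) γ r) (velocity (d := d) γ r))
    (by
      filter_upwards [eventually_mem_source hγ.smooth.continuousOn hr hx] with τ hτ
      exact inner_velocity_eq_sum hγ.smooth hτ.1 he hτ.2)
    (inner_velocity_eq_sum hγ.smooth hr he hx)
  refine h'.congr_deriv ?_
  -- The derivative of `g(V, V)` is `(∂_σ g)(V, V) V^σ + 2 g(V, A)`; the second term is minus the
  -- first.
  have h1 := sum_metric_geodesicAccel he hx (V r)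
  rw [← hA] at h1
  have h2 : ∑ α, ∑ β, metricMatrix e (γ r) α β * A α * V r β =
      ∑ α, ∑ β, metricMatrix e (γ r) α β * V r α * A β := by
    rw [Finset.sum_comm]
    refine Finset.sum_congr rfl fun α _ => Finset.sum_congr rfl fun β _ => ?_
    rw [metricMatrix_comm]
    ring
  have h3 : ∀ α β, ((∑ σ, dMetric e (γ r) σ α β * V r σ) * V r α + metricMatrix e (γ r) α β * A α)
        * V r β + metricMatrix e (γ r) α β * V r α * A β =
      (∑ σ, dMetric e (γ r) σ α β * V r σ * V r α * V r β)
        + metricMatrix e (γ r) α β * A α * V r β + metricMatrix e (γ r) α β * V r α * A β := by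
    intro α β
    rw [← Finset.sum_mul, ← Finset.sum_mul]
    ring
  refine (Finset.sum_congr rfl fun α _ => Finset.sum_congr rfl fun β _ => h3 α β).trans ?_
  simp_rw [Finset.sum_add_distrib]
  rw [h2, h1]
  ring

/-- The pairing of a parallel covector with the velocity of a geodesic is constant. -/
lemma IsParallelAlong.pairing_velocity {ζ : (s : ℝ) → TangentSpace (𝓡 d) (γ s) →L[ℝ] ℝ}
    (hζ : IsParallelAlong γ ζ) (hγ : IsGeodesic (d := d) γ) (hs : s ∈ Icc (0 : ℝ) 1) :
    ζ s (velocity γ s) = ζ 0 (velocity γ 0) := by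
  refine eq_of_hasDerivWithinAt_zero (s := s) (f := fun r => ζ r (velocity γ r)) ?_ hs
  intro r hr
  set e := chartAt (Coord d) (γ r)
  have he : IsCoordSystem e := IsManifold.chart_mem_maximalAtlas _
  have hx : γ r ∈ e.source := mem_chart_source _ _
  set V := fun r => derivWithin (fun τ => e (γ τ)) (Icc 0 1) r with hV
  have hD : HasDerivWithinAt V (geodesicAccel e (γ r) (V r)) (Icc 0 1) r :=
    hγ.hasDerivWithinAt hr he hx
  have hp : ∀ τ ∈ Icc (0 : ℝ) 1, γ τ ∈ e.source → ζ τ (velocity γ τ) =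
      ∑ α, components e ⟨γ τ, ζ τ⟩ α * V τ α := by
    intro τ hτ hxτ
    have := pairing_eq_sum he (⟨γ τ, ζ τ⟩ : Cotangent d M) hxτ (velocity γ τ)
    rw [vecComponents_velocity hγ.smooth hτ he hxτ] at this
    exact this
  have h := HasDerivWithinAt.fun_sum (u := Finset.univ) fun α _ =>
    (hζ r hr e he hx α).mul (hasDerivWithinAt_apply hD α)
  have h' := h.congr_of_eventuallyEq (f₁ := fun r => ζ r (velocity γ r))
    (by
      filter_upwards [eventually_mem_source hγ.smooth.continuousOn hr hx] with τ hτ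
      exact hp τ hτ.1 hτ.2)
    (hp r hr hx)
  refine h'.congr_deriv ?_
  simp_rw [derivWithin_coord_apply hγ.smooth hr he hx]
  set c := components e ⟨γ r, ζ r⟩
  -- The term `Γ^μ_{αν} ζ_μ V^ν V^α` from parallel transport cancels the term `-ζ_μ Γ^μ_{αν} V^α
  -- V^ν` from the geodesic equation.
  rw [Finset.sum_add_distrib]
  simp only [geodesicAccel, mul_neg, Finset.sum_neg_distrib, Finset.mul_sum, Finset.sum_mul]
  rw [← sub_eq_add_neg, sub_eq_zero, Finset.sum_comm]
  refine Finset.sum_congr rfl fun α _ => Finset.sum_congr rfl fun β _ =>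
    Finset.sum_congr rfl fun ν _ => ?_
  change christoffel e (γ r) α β ν * c α * V r ν * V r β =
    c α * (christoffel e (γ r) α β ν * V r β * V r ν)
  ring

lemma mul_mem_Icc {c r : ℝ} (hc : c ∈ Ioc (0 : ℝ) 1) (hr : r ∈ Icc (0 : ℝ) 1) :
    c * r ∈ Icc (0 : ℝ) 1 :=
  ⟨mul_nonneg hc.1.le hr.1, mul_le_one₀ hc.2 hr.1 hr.2⟩

lemma contMDiffOn_comp_mul (hγ : ContMDiffOn 𝓘(ℝ, ℝ) (𝓡 d) ∞ γ (Icc 0 1)) {c : ℝ}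
    (hc : c ∈ Ioc (0 : ℝ) 1) :
    ContMDiffOn 𝓘(ℝ, ℝ) (𝓡 d) ∞ (fun r => γ (c * r)) (Icc 0 1) :=
  hγ.comp (contDiff_const.mul contDiff_id).contMDiff.contMDiffOn fun _ hr => mul_mem_Icc hc hr

lemma hasDerivWithinAt_comp_mul {E : Type*} [NormedAddCommGroup E] [NormedSpace ℝ E]
    {f : ℝ → E} {f' : E} {c : ℝ} (hc : c ∈ Ioc (0 : ℝ) 1)
    (hf : HasDerivWithinAt f f' (Icc 0 1) (c * s)) :
    HasDerivWithinAt (fun r => f (c * r)) (c • f') (Icc 0 1) s := by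
  have h : HasDerivWithinAt (fun r : ℝ => c * r) c (Icc 0 1) s := by
    simpa using (hasDerivWithinAt_id s (Icc (0 : ℝ) 1)).const_mul c
  exact hf.scomp s h fun r hr => mul_mem_Icc hc hr

lemma derivWithin_coord_comp_mul (hγ : ContMDiffOn 𝓘(ℝ, ℝ) (𝓡 d) ∞ γ (Icc 0 1))
    (hs : s ∈ Icc (0 : ℝ) 1) (he : IsCoordSystem e) {c : ℝ} (hc : c ∈ Ioc (0 : ℝ) 1)
    (hx : γ (c * s) ∈ e.source) :
    derivWithin (fun r => e (γ (c * r))) (Icc 0 1) s =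
      c • derivWithin (fun r => e (γ r)) (Icc 0 1) (c * s) :=
  (hasDerivWithinAt_comp_mul hc (hasDerivWithinAt_coord hγ (mul_mem_Icc hc hs) he hx)).derivWithin
    (uniqueDiffOn_Icc zero_lt_one s hs)

/-- Both terms of the geodesic equation are homogeneous of degree two in the parameter scale, so
each picks up a factor `c²`. -/
lemma IsGeodesic.comp_mul (hγ : IsGeodesic (d := d) γ) {c : ℝ} (hc : c ∈ Ioc (0 : ℝ) 1) :
    IsGeodesic (d := d) (fun r => γ (c * r)) where
  smooth := contMDiffOn_comp_mul hγ.smooth hc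
  equation := by
    intro s hs e he hx μ
    have hsm := contMDiffOn_comp_mul hγ.smooth hc
    have hcs := mul_mem_Icc hc hs
    have h1 := hasDerivWithinAt_comp_mul hc (hγ.hasDerivWithinAt hcs he hx)
    have h2 : HasDerivWithinAt (fun r => derivWithin (fun τ => e (γ (c * τ)) μ) (Icc 0 1) r)
        (c * (c * geodesicAccel e (γ (c * s))
          (derivWithin (fun τ => e (γ τ)) (Icc 0 1) (c * s)) μ)) (Icc 0 1) s := by
      refine ((hasDerivWithinAt_apply h1 μ).const_mul c).congr_of_eventuallyEq ?_ ?_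
      · filter_upwards [eventually_mem_source hsm.continuousOn hs hx] with r hr
        rw [derivWithin_coord_apply hsm hr.1 he hr.2,
          derivWithin_coord_comp_mul hγ.smooth hr.1 he hc hr.2]
        simp
      · rw [derivWithin_coord_apply hsm hs he hx, derivWithin_coord_comp_mul hγ.smooth hs he hc hx]
        simp
    rw [h2.derivWithin (uniqueDiffOn_Icc zero_lt_one s hs)]
    simp_rw [derivWithin_coord_apply hsm hs he hx, derivWithin_coord_comp_mul hγ.smooth hs he hc hx]
    simp only [geodesicAccel, PiLp.smul_apply, smul_eq_mul, mul_neg, Finset.mul_sum]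
    rw [neg_add_eq_zero]
    exact Finset.sum_congr rfl fun α _ => Finset.sum_congr rfl fun ν _ => by ring

lemma norm_velocity_zero_comp_mul (hγ : ContMDiffOn 𝓘(ℝ, ℝ) (𝓡 d) ∞ γ (Icc 0 1)) {c : ℝ}
    (hc : c ∈ Ioc (0 : ℝ) 1) :
    ‖velocity (d := d) (fun r => γ (c * r)) 0‖ = c * ‖velocity (d := d) γ 0‖ := by
  set e := chartAt (Coord d) (γ 0)
  have he : IsCoordSystem e := IsManifold.chart_mem_maximalAtlas _
  have hx : γ 0 ∈ e.source := mem_chart_source _ _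
  have hx' : γ (c * 0) ∈ e.source := by rwa [mul_zero]
  have h0 : (0 : ℝ) ∈ Icc (0 : ℝ) 1 := by simp
  have h1 := inner_velocity_eq_sum (contMDiffOn_comp_mul hγ hc) h0 he hx'
  have h2 := inner_velocity_eq_sum hγ h0 he hx
  rw [derivWithin_coord_comp_mul hγ h0 he hc hx'] at h1
  rw [real_inner_self_eq_norm_sq] at h1 h2
  refine (sq_eq_sq₀ (norm_nonneg _) (mul_nonneg hc.1.le (norm_nonneg _))).1 ?_
  rw [h1, mul_pow, h2, Finset.mul_sum]
  simp_rw [mul_zero, Finset.mul_sum]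
  refine Finset.sum_congr rfl fun α _ => Finset.sum_congr rfl fun ν _ => ?_
  simp only [PiLp.smul_apply, smul_eq_mul]
  ring

lemma IsGeodesic.pathELength_eq (hγ : IsGeodesic (d := d) γ) {a b : ℝ} (ha : 0 ≤ a)
    (hb : b ≤ 1) :
    pathELength (𝓡 d) γ a b = ENNReal.ofReal ((b - a) * ‖velocity (d := d) γ 0‖) := by
  rw [pathELength_eq_lintegral_mfderiv_Ioo]
  have h : ∀ t ∈ Ioo a b, ‖mfderiv 𝓘(ℝ, ℝ) (𝓡 d) γ t (1 : ℝ)‖ₑ =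
      ENNReal.ofReal ‖velocity (d := d) γ 0‖ := by
    intro t ht
    have ht' : t ∈ Ioo (0 : ℝ) 1 := ⟨ha.trans_lt ht.1, ht.2.trans_le hb⟩
    rw [← hγ.norm_velocity (Ioo_subset_Icc_self ht'), ofReal_norm, velocity,
      mfderivWithin_of_mem_nhds (Icc_mem_nhds ht'.1 ht'.2)]
  refine (setLIntegral_congr_fun measurableSet_Ioo h).trans ?_
  rw [setLIntegral_const, Real.volume_Ioo, mul_comm,
    ENNReal.ofReal_mul' (norm_nonneg _)]

/-! ### Shortest geodesics and the Riemannian distance -/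

variable [IsRiemannianManifold (𝓡 d) M]

lemma IsGeodesic.dist_le (hγ : IsGeodesic (d := d) γ) {a b : ℝ} (ha : 0 ≤ a) (hab : a ≤ b)
    (hb : b ≤ 1) : dist (γ a) (γ b) ≤ (b - a) * ‖velocity (d := d) γ 0‖ := by
  have h1 : edist (γ a) (γ b) ≤ pathELength (𝓡 d) γ a b := by
    rw [IsRiemannianManifold.out (I := 𝓡 d) (γ a) (γ b)]
    exact riemannianEDist_le_pathELength
      ((hγ.smooth.mono (Icc_subset_Icc ha hb)).of_le (by norm_cast)) rfl rfl hab
  rw [hγ.pathELength_eq ha hb, edist_dist] at h1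
  exact (ENNReal.ofReal_le_ofReal_iff (mul_nonneg (sub_nonneg.2 hab) (norm_nonneg _))).1 h1

lemma IsShortestGeodesic.norm_velocity {z : M} (hγ : IsShortestGeodesic (d := d) γ z x) :
    ‖velocity (d := d) γ 0‖ = dist z x := by
  have h := hγ.shortest
  rw [hγ.isGeodesic.pathELength_eq le_rfl le_rfl, edist_dist, sub_zero, one_mul] at h
  exact (ENNReal.ofReal_eq_ofReal_iff (norm_nonneg _) dist_nonneg).1 h

/-- The lengths of the two pieces bound the two distances from above and add up to `dist z x`, so
the triangle inequality forces equality in both. -/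
lemma IsShortestGeodesic.dist_eq {z : M} (hγ : IsShortestGeodesic (d := d) γ z x)
    (hs : s ∈ Icc (0 : ℝ) 1) : dist z (γ s) = s * dist z x := by
  have h1 := hγ.isGeodesic.dist_le le_rfl hs.1 hs.2
  have h2 := hγ.isGeodesic.dist_le hs.1 hs.2 le_rfl
  rw [hγ.norm_velocity, hγ.start] at h1
  rw [hγ.norm_velocity, hγ.finish] at h2
  have h3 := dist_triangle z (γ s) x
  linarith

lemma IsShortestGeodesic.comp_mul {z : M} (hγ : IsShortestGeodesic (d := d) γ z x)
    (hs : s ∈ Ioc (0 : ℝ) 1) :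
    IsShortestGeodesic (d := d) (fun r => γ (s * r)) z (γ s) where
  isGeodesic := hγ.isGeodesic.comp_mul hs
  start := by simp [hγ.start]
  finish := by simp
  shortest := by
    rw [(hγ.isGeodesic.comp_mul hs).pathELength_eq le_rfl le_rfl,
      norm_velocity_zero_comp_mul hγ.isGeodesic.smooth hs, hγ.norm_velocity, edist_dist,
      hγ.dist_eq (Ioc_subset_Icc_self hs), sub_zero, one_mul]

/-- A geodesic neighbourhood of `z` is a neighbourhood of `z`. -/
lemma IsGeodesicNhd.mem_nhds {z : M} {U : Set M} (hU : IsGeodesicNhd (d := d) z U) :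
    U ∈ 𝓝 z := by
  obtain ⟨E, h0, -, rfl, hexp, -, -⟩ := hU
  obtain ⟨γ, hγ, hv, h1⟩ := hexp 0 h0
  have hz : γ 0 = z := congrArg TotalSpace.proj hv
  -- A geodesic with zero initial velocity has zero length, hence `E 0 = z`.
  have hn : ‖velocity (d := d) γ 0‖ = 0 := by
    have : ‖velocity (d := d) γ 0‖ = ‖(0 : TangentSpace (𝓡 d) z)‖ :=
      congrArg (fun p : TangentBundle (𝓡 d) M => ‖p.2‖) hv
    rw [this, norm_zero]
  have h := hγ.dist_le le_rfl zero_le_one le_rfl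
  rw [hn, mul_zero, hz, h1] at h
  have : E 0 = z := (dist_le_zero.1 h).symm
  rw [← this]
  exact E.open_target.mem_nhds (E.map_source h0)

end

/-! ### Local estimates and density of the directions of shortest geodesics -/

section

lemma Coord.abs_apply_le {d : ℕ} (v : Coord d) (α : Fin d) : |v α| ≤ ‖v‖ :=
  PiLp.norm_apply_le v α

lemma Coord.norm_le_sum {d : ℕ} (v : Coord d) : ‖v‖ ≤ ∑ α, |v α| := by
  conv_lhs => rw [Coord.sum_single v]
  refine (norm_sum_le _ _).trans (Finset.sum_le_sum fun α _ => ?_)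
  simp [norm_smul]

variable {d : ℕ} {M : Type*} [MetricSpace M] [ChartedSpace (Coord d) M] [IsManifold (𝓡 d) ∞ M]
  [RiemannianBundle (fun x : M => TangentSpace (𝓡 d) x)]
  [IsContMDiffRiemannianBundle (𝓡 d) ∞ (Coord d) (fun x : M => TangentSpace (𝓡 d) x)]
  {e : OpenPartialHomeomorph M (Coord d)} {x z : M} {γ : ℝ → M} {s : ℝ}

lemma continuousAt_metricMatrix (he : IsCoordSystem e) (hz : z ∈ e.source) (α β : Fin d) :
    ContinuousAt (fun x => metricMatrix e x α β) z := by
  have h := ((contDiffOn_metricMatrix he α β).continuousOn.continuousAt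
    (e.open_target.mem_nhds (e.map_source hz))).comp (e.continuousAt hz)
  refine h.congr ?_
  filter_upwards [e.open_source.mem_nhds hz] with y hy
  simp [e.left_inv hy]

lemma continuousAt_christoffel (he : IsCoordSystem e) (hz : z ∈ e.source) (μ α ν : Fin d) :
    ContinuousAt (fun x => christoffel e x μ α ν) z := by
  have h := ((continuousOn_christoffel he μ α ν).continuousAt
    (e.open_target.mem_nhds (e.map_source hz))).comp (e.continuousAt hz)
  refine h.congr ?_
  filter_upwards [e.open_source.mem_nhds hz] with y hy
  simp [e.left_inv hy]

/-- The quadratic form of the metric, in components. -/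
def metricForm (e : OpenPartialHomeomorph M (Coord d)) (x : M) (v : Coord d) : ℝ :=
  ∑ α, ∑ β, metricMatrix e x α β * v α * v β

lemma metricForm_pos (he : IsCoordSystem e) (hx : x ∈ e.source) {v : Coord d} (hv : v ≠ 0) :
    0 < metricForm e x v := by
  have h0 : vecOfComponents e x v ≠ 0 := by
    intro h
    have := vecComponents_vecOfComponents he hx v
    rw [h, map_zero] at this
    exact hv this.symm
  have h1 := real_inner_self_pos.2 h0
  rwa [inner_eq_sum he hx, vecComponents_vecOfComponents he hx] at h1

lemma metricForm_smul (x : M) (c : ℝ) (v : Coord d) :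
    metricForm e x (c • v) = c ^ 2 * metricForm e x v := by
  simp only [metricForm, PiLp.smul_apply, smul_eq_mul, Finset.mul_sum]
  exact Finset.sum_congr rfl fun α _ => Finset.sum_congr rfl fun ν _ => by ring

/-- Positivity on the compact unit sphere at `z` persists uniformly for nearby `x`; homogeneity
extends it to all `v`. -/
lemma exists_metricForm_ge (he : IsCoordSystem e) (hz : z ∈ e.source) :
    ∃ c > 0, ∀ᶠ x in 𝓝 z, ∀ v, c * ‖v‖ ^ 2 ≤ metricForm e x v := by
  have hcont : ∀ v : Coord d,
      ContinuousAt (fun p : M × Coord d => metricForm e p.1 p.2) (z, v) := by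
    intro v
    unfold metricForm
    refine tendsto_finsetSum _ fun α _ => tendsto_finsetSum _ fun β _ => ?_
    have h1 : ContinuousAt (fun p : M × Coord d => metricMatrix e p.1 α β) (z, v) :=
      ContinuousAt.comp (g := fun x => metricMatrix e x α β) (f := Prod.fst) (continuousAt_metricMatrix he hz α β) continuousAt_fst
    have h2 : ∀ α, Continuous (fun p : M × Coord d => p.2 α) := fun α => by fun_prop
    exact (h1.mul (h2 α).continuousAt).mul (h2 β).continuousAt
  have hK : IsCompact (Metric.sphere (0 : Coord d) 1) := isCompact_sphere _ _
  obtain ⟨c, hc, hcK⟩ := hK.exists_forall_le' (f := fun v => metricForm e z v) (a := 0)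
    (fun v _ => ((hcont v).comp (f := fun v => (z, v)) (by fun_prop)).continuousWithinAt)
    (fun v hv => metricForm_pos he hz (by rintro rfl; simp at hv))
  refine ⟨c / 2, half_pos hc, ?_⟩
  have h : ∀ᶠ x in 𝓝 z, ∀ v ∈ Metric.sphere (0 : Coord d) 1, c / 2 < metricForm e x v := by
    refine hK.eventually_forall_of_forall_eventually fun v hv => ?_
    exact (hcont v).eventually (lt_mem_nhds ((half_lt_self hc).trans_le (hcK v hv)))
  filter_upwards [h] with x hx v
  by_cases hv : v = 0
  · simp [hv, metricForm]
  have hv' : ‖v‖ ≠ 0 := norm_ne_zero_iff.2 hv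
  have h1 := hx (‖v‖⁻¹ • v) (by simp [norm_smul, hv'])
  have h2 := metricForm_smul (e := e) x ‖v‖ (‖v‖⁻¹ • v)
  rw [smul_smul, mul_inv_cancel₀ hv', one_smul] at h2
  rw [h2, mul_comm]
  gcongr

/-- A bound at the single point `z` is enough: it is applied only to initial velocities. -/
lemma exists_metricForm_le (e : OpenPartialHomeomorph M (Coord d)) (z : M) :
    ∃ C ≥ 0, ∀ v, metricForm e z v ≤ C * ‖v‖ ^ 2 := by
  refine ⟨∑ α, ∑ β, |metricMatrix e z α β|, by positivity, fun v => ?_⟩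
  simp only [metricForm, Finset.sum_mul]
  refine Finset.sum_le_sum fun α _ => Finset.sum_le_sum fun β _ => ?_
  calc metricMatrix e z α β * v α * v β ≤ |metricMatrix e z α β * v α * v β| := le_abs_self _
    _ = |metricMatrix e z α β| * (|v α| * |v β|) := by rw [abs_mul, abs_mul, mul_assoc]
    _ ≤ |metricMatrix e z α β| * (‖v‖ * ‖v‖) := by
        gcongr <;> exact Coord.abs_apply_le v _
    _ = _ := by rw [sq]

lemma exists_norm_geodesicAccel_le (he : IsCoordSystem e) (hz : z ∈ e.source) :
    ∃ C ≥ 0, ∀ᶠ x in 𝓝 z, ∀ v, ‖geodesicAccel e x v‖ ≤ C * ‖v‖ ^ 2 := by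
  refine ⟨∑ μ : Fin d, ∑ α, ∑ ν, (|christoffel e z μ α ν| + 1), by positivity, ?_⟩
  have h : ∀ᶠ x in 𝓝 z, ∀ μ α ν, |christoffel e x μ α ν| < |christoffel e z μ α ν| + 1 := by
    simp only [Filter.eventually_all]
    exact fun μ α ν => (continuousAt_christoffel he hz μ α ν).abs.eventually
      (gt_mem_nhds (lt_add_one _))
  filter_upwards [h] with x hx v
  refine (Coord.norm_le_sum _).trans ?_
  simp only [geodesicAccel, abs_neg, Finset.sum_mul]
  refine Finset.sum_le_sum fun μ _ => (Finset.abs_sum_le_sum_abs _ _).trans ?_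
  refine Finset.sum_le_sum fun α _ => (Finset.abs_sum_le_sum_abs _ _).trans ?_
  refine Finset.sum_le_sum fun ν _ => ?_
  rw [abs_mul, abs_mul, mul_assoc, sq]
  have := hx μ α ν
  gcongr <;> exact Coord.abs_apply_le v _

lemma IsGeodesic.metricForm_velocity (hγ : IsGeodesic (d := d) γ)
    (hs : s ∈ Icc (0 : ℝ) 1) (he : IsCoordSystem e) (hx : γ s ∈ e.source) :
    metricForm e (γ s) (derivWithin (fun r => e (γ r)) (Icc 0 1) s) =
      ‖velocity (d := d) γ 0‖ ^ 2 := by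
  rw [metricForm, ← inner_velocity_eq_sum hγ.smooth hs he hx, real_inner_self_eq_norm_sq,
    hγ.norm_velocity hs]

variable [IsRiemannianManifold (𝓡 d) M]

/-- In local coordinates, the endpoint of a short shortest geodesic is given by its initial velocity
up to a quadratic error. -/
lemma exists_initial_velocity_estimate (he : IsCoordSystem e) (hz : z ∈ e.source) :
    ∃ C ≥ 0, ∃ C' ≥ 0, ∀ᶠ x in 𝓝 z, ∀ γ : ℝ → M, IsShortestGeodesic (d := d) γ z x →
      ‖derivWithin (fun r => e (γ r)) (Icc 0 1) 0‖ ≤ C' * dist z x ∧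
      ‖e x - e z - derivWithin (fun r => e (γ r)) (Icc 0 1) 0‖ ≤
        C * ‖derivWithin (fun r => e (γ r)) (Icc 0 1) 0‖ ^ 2 := by
  obtain ⟨c, hc, hlow⟩ := exists_metricForm_ge he hz
  obtain ⟨C₁, hC₁, hup⟩ := exists_metricForm_le e z
  obtain ⟨C₂, hC₂, hacc⟩ := exists_norm_geodesicAccel_le he hz
  obtain ⟨δ, hδ, hball⟩ := Metric.eventually_nhds_iff.1
    ((hlow.and hacc).and (e.open_source.mem_nhds hz))
  -- With `V` the coordinate velocity, the conserved form `g(V, V) = dist²` gives `‖V s‖² ≤ dist² /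
  -- c` along the curve and `dist² ≤ C₁ ‖V 0‖²` at its start. So the acceleration is at most `C₂ (C₁
  -- / c) ‖V 0‖²`.
  refine ⟨C₂ * (C₁ / c), by positivity, √(1 / c), by positivity, ?_⟩
  filter_upwards [Metric.ball_mem_nhds z hδ] with x hx γ hγ
  have hmem : ∀ s ∈ Icc (0 : ℝ) 1, dist (γ s) z < δ := by
    intro s hs
    rw [dist_comm, hγ.dist_eq hs]
    rw [Metric.mem_ball, dist_comm] at hx
    exact (mul_le_of_le_one_left dist_nonneg hs.2).trans_lt hx
  have h0 : (0 : ℝ) ∈ Icc (0 : ℝ) 1 := by simp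
  have h1 : (1 : ℝ) ∈ Icc (0 : ℝ) 1 := by simp
  set V := fun s => derivWithin (fun r => e (γ r)) (Icc 0 1) s with hV
  have hg : ∀ s ∈ Icc (0 : ℝ) 1, metricForm e (γ s) (V s) = dist z x ^ 2 := by
    intro s hs
    rw [hV, hγ.isGeodesic.metricForm_velocity hs he (hball (hmem s hs)).2, hγ.norm_velocity]
  have hVs : ∀ s ∈ Icc (0 : ℝ) 1, ‖V s‖ ^ 2 ≤ dist z x ^ 2 / c := by
    intro s hs
    rw [le_div_iff₀ hc, mul_comm, ← hg s hs]
    exact (hball (hmem s hs)).1.1 _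
  have hdist : dist z x ^ 2 ≤ C₁ * ‖V 0‖ ^ 2 := by
    rw [← hg 0 h0]
    have := hup (V 0)
    rwa [← hγ.start] at this
  set B := C₂ * (C₁ / c) * ‖V 0‖ ^ 2 with hB
  have hA : ∀ s ∈ Icc (0 : ℝ) 1, ‖geodesicAccel e (γ s) (V s)‖ ≤ B := by
    intro s hs
    calc _ ≤ C₂ * ‖V s‖ ^ 2 := (hball (hmem s hs)).1.2 _
      _ ≤ C₂ * ((C₁ * ‖V 0‖ ^ 2) / c) := by
        gcongr
        exact (hVs s hs).trans (by gcongr)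
      _ = B := by rw [hB]; ring
  have hB0 : 0 ≤ B := by positivity
  have hVB : ∀ s ∈ Icc (0 : ℝ) 1, ‖V s - V 0‖ ≤ B := by
    intro s hs
    have := (convex_Icc (0 : ℝ) 1).norm_image_sub_le_of_norm_hasDerivWithin_le
      (fun r hr => hγ.isGeodesic.hasDerivWithinAt hr he (hball (hmem r hr)).2) hA h0 hs
    refine this.trans (mul_le_of_le_one_right hB0 ?_)
    rw [sub_zero, Real.norm_of_nonneg hs.1]
    exact hs.2
  refine ⟨?_, ?_⟩
  · have := Real.le_sqrt_of_sq_le (hVs 0 h0)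
    rwa [div_eq_mul_one_div, mul_comm, Real.sqrt_mul (by positivity), Real.sqrt_sq dist_nonneg]
      at this
  -- A second use of the mean value inequality, now for the deviation of the curve from its tangent
  -- line.
  · have hk : ∀ s ∈ Icc (0 : ℝ) 1,
        HasDerivWithinAt (fun r => e (γ r) - r • V 0) (V s - V 0) (Icc 0 1) s := by
      intro s hs
      have h2 := (hasDerivWithinAt_id s (Icc (0 : ℝ) 1)).smul_const (V 0)
      rw [one_smul] at h2
      exact (hasDerivWithinAt_coord hγ.isGeodesic.smooth hs he (hball (hmem s hs)).2).sub h2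
    have := (convex_Icc (0 : ℝ) 1).norm_image_sub_le_of_norm_hasDerivWithin_le hk hVB h0 h1
    simp only [hγ.start, hγ.finish, zero_smul, one_smul, sub_zero, norm_one, mul_one] at this
    rwa [sub_right_comm] at this

/-- A closed cone containing the initial velocities of shortest geodesics to all points near `z` is
the whole space. -/
lemma mem_cone_of_initial_velocities (he : IsCoordSystem e) (hz : z ∈ e.source)
    {K : Set (Coord d)} (hK : IsClosed K) (hcone : ∀ c > (0 : ℝ), ∀ w ∈ K, c • w ∈ K)
    (h : ∀ᶠ x in 𝓝 z, ∃ γ : ℝ → M, IsShortestGeodesic (d := d) γ z x ∧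
      derivWithin (fun r => e (γ r)) (Icc 0 1) 0 ∈ K) (u : Coord d) : u ∈ K := by
  obtain ⟨C, hC, C', hC', hest⟩ := exists_initial_velocity_estimate he hz
  have hlim : Filter.Tendsto (fun r : ℝ => e.symm (e z + r • u)) (𝓝[>] 0) (𝓝 z) := by
    have h1 : ContinuousAt (fun r : ℝ => e.symm (e z + r • u)) 0 := by
      refine ContinuousAt.comp (g := e.symm) (f := fun r : ℝ => e z + r • u) ?_ (by fun_prop)
      simpa using e.continuousAt_symm (e.map_source hz)
    have h2 := h1.tendsto
    simp only [zero_smul, add_zero, e.left_inv hz] at h2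
    exact h2.mono_left nhdsWithin_le_nhds
  have htar : ∀ᶠ r : ℝ in 𝓝[>] 0, e z + r • u ∈ e.target := by
    have h1 : ContinuousAt (fun r : ℝ => e z + r • u) 0 := by fun_prop
    have h2 := h1.tendsto
    simp only [zero_smul, add_zero] at h2
    exact (h2.mono_left nhdsWithin_le_nhds).eventually (e.open_target.mem_nhds (e.map_source hz))
  have hdist : ∀ᶠ r : ℝ in 𝓝[>] 0, C * (C' * dist z (e.symm (e z + r • u))) < 1 / 2 := by
    have h1 : Filter.Tendsto (fun r : ℝ => C * (C' * dist z (e.symm (e z + r • u)))) (𝓝[>] 0)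
        (𝓝 (C * (C' * dist z z))) := ((tendsto_const_nhds.dist hlim).const_mul _).const_mul _
    rw [dist_self, mul_zero, mul_zero] at h1
    exact h1.eventually (gt_mem_nhds (by norm_num))
  rw [← hK.closure_eq, Metric.mem_closure_iff]
  intro ε hε
  have hsmall : ∀ᶠ r : ℝ in 𝓝[>] 0, 4 * C * ‖u‖ ^ 2 * r < ε := by
    have h1 : Filter.Tendsto (fun r : ℝ => 4 * C * ‖u‖ ^ 2 * r) (𝓝 0) (𝓝 (4 * C * ‖u‖ ^ 2 * 0)) :=
      Filter.tendsto_id.const_mul _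
    rw [mul_zero] at h1
    exact (h1.mono_left nhdsWithin_le_nhds).eventually (gt_mem_nhds hε)
  -- For the point with coordinates `e z + r u` the velocity `W` satisfies `‖r u - W‖ ≤ C ‖W‖²`.
  -- Since `C ‖W‖ ≤ 1/2`, the error is absorbed and `‖W‖ ≤ 2 r ‖u‖`, so `‖u - W / r‖ ≤ 4 C ‖u‖² r`,
  -- which is below the given tolerance.
  obtain ⟨r, ⟨⟨hr1, γ, hγ, hW⟩, hr2, hr3⟩, hr4, hr : 0 < r⟩ :=
    ((hlim.eventually (hest.and h)).and (htar.and hdist)).and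
      (hsmall.and self_mem_nhdsWithin) |>.exists
  obtain ⟨h1, h2⟩ := hr1 γ hγ
  set W := derivWithin (fun r => e (γ r)) (Icc 0 1) 0
  rw [e.right_inv hr2, add_sub_cancel_left] at h2
  have h3 : C * ‖W‖ ≤ 1 / 2 := (mul_le_mul_of_nonneg_left h1 hC).trans hr3.le
  have h4 : ‖W‖ ≤ 2 * (r * ‖u‖) := by
    have h5 : ‖W‖ ≤ ‖r • u‖ + ‖r • u - W‖ := by
      rw [← norm_neg (r • u - W)]
      refine le_trans (le_of_eq ?_) (norm_add_le _ _)
      congr 1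
      abel
    rw [norm_smul, Real.norm_of_nonneg hr.le] at h5
    nlinarith [norm_nonneg W]
  refine ⟨r⁻¹ • W, hcone _ (inv_pos.2 hr) _ hW, ?_⟩
  have h6 : dist u (r⁻¹ • W) = r⁻¹ * ‖r • u - W‖ := by
    rw [dist_eq_norm, ← Real.norm_of_nonneg (inv_pos.2 hr).le, ← norm_smul, smul_sub, smul_smul,
      Real.norm_of_nonneg (inv_pos.2 hr).le, inv_mul_cancel₀ hr.ne', one_smul]
  rw [h6]
  calc r⁻¹ * ‖r • u - W‖ ≤ r⁻¹ * (C * (2 * (r * ‖u‖)) ^ 2) := by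
        gcongr
        exact h2.trans (by gcongr)
    _ = 4 * C * ‖u‖ ^ 2 * r := by field_simp; ring
    _ < ε := hr4

end

/-! ### The first and second `x`-derivatives of the phase at `x*` -/

section

/-- A symmetric bilinear form is determined by its quadratic form, in coordinates. -/
lemma bilin_eq_sum_of_diag {d : ℕ} (B : Coord d →L[ℝ] Coord d →L[ℝ] ℂ)
    (hB : ∀ v w, B v w = B w v) (S : Fin d → Fin d → ℂ) (hS : ∀ α β, S α β = S β α)
    (h : ∀ v : Coord d, B v v = ∑ α, ∑ β, S α β * (v α : ℂ) * (v β : ℂ)) (v w : Coord d) :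
    B v w = ∑ α, ∑ β, S α β * (v α : ℂ) * (w β : ℂ) := by
  have h1 := h (v + w)
  have h2 : ∑ α, ∑ β, S α β * (w α : ℂ) * (v β : ℂ) = ∑ α, ∑ β, S α β * (v α : ℂ) * (w β : ℂ) := by
    rw [Finset.sum_comm]
    refine Finset.sum_congr rfl fun α _ => Finset.sum_congr rfl fun β _ => ?_
    rw [hS]
    ring
  have h3 : ∑ α, ∑ β, S α β * (((v + w) α : ℝ) : ℂ) * (((v + w) β : ℝ) : ℂ) =
      ∑ α, ∑ β, S α β * (v α : ℂ) * (v β : ℂ) + ∑ α, ∑ β, S α β * (w α : ℂ) * (w β : ℂ)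
      + (∑ α, ∑ β, S α β * (v α : ℂ) * (w β : ℂ) + ∑ α, ∑ β, S α β * (w α : ℂ) * (v β : ℂ)) := by
    simp_rw [← Finset.sum_add_distrib]
    refine Finset.sum_congr rfl fun α _ => Finset.sum_congr rfl fun β _ => ?_
    simp only [PiLp.add_apply, Complex.ofReal_add]
    ring
  rw [h3, h2, ← h v, ← h w] at h1
  simp only [map_add, add_apply] at h1
  rw [hB w v] at h1
  linear_combination h1 / 2

/-- First and second order information on a function from its values along a curve. -/
lemma fderiv_of_eq_along_curve {E : Type*} [NormedAddCommGroup E] [NormedSpace ℝ E]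
    {f : E → ℂ} {k V : ℝ → E} {A : E} {a b : ℂ} (hf : ContDiffAt ℝ ∞ f (k 0))
    (hk : ∀ᶠ s in 𝓝[Icc 0 1] (0 : ℝ), HasDerivWithinAt k (V s) (Icc 0 1) s)
    (hV : HasDerivWithinAt V A (Icc 0 1) 0)
    (heq : ∀ᶠ s in 𝓝[Icc 0 1] (0 : ℝ), f (k s) = (s : ℂ) * a + (s : ℂ) ^ 2 * b) :
    fderiv ℝ f (k 0) (V 0) = a ∧
      fderiv ℝ (fderiv ℝ f) (k 0) (V 0) (V 0) + fderiv ℝ f (k 0) A = 2 * b := by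
  have h0 : (0 : ℝ) ∈ Icc (0 : ℝ) 1 := by simp
  have hk0 := hk.self_of_nhdsWithin h0
  have hofReal : ∀ s : ℝ, HasDerivWithinAt (fun s : ℝ => (s : ℂ)) 1 (Icc 0 1) s :=
    fun s => Complex.ofRealCLM.hasDerivWithinAt
  have hpoly : ∀ s : ℝ, HasDerivWithinAt (fun s : ℝ => (s : ℂ) * a + (s : ℂ) ^ 2 * b)
      (a + 2 * (s : ℂ) * b) (Icc 0 1) s := by
    intro s
    refine (((hofReal s).mul_const a).fun_add (((hofReal s).fun_pow 2).mul_const b)).congr_deriv ?_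
    simp
  have hdiff : ∀ᶠ s in 𝓝[Icc 0 1] (0 : ℝ), DifferentiableAt ℝ f (k s) := by
    have h1 : ∀ᶠ y in 𝓝 (k 0), DifferentiableAt ℝ f y :=
      ((hf.of_le (m := 1) (by norm_cast)).eventually (by simp)).mono
        fun y hy => hy.differentiableAt one_ne_zero
    exact hk0.continuousWithinAt.eventually h1
  -- The first derivatives agree for all small `s ≥ 0`, not only at `0`, so this identity can be
  -- differentiated once more.
  have hev : ∀ᶠ s in 𝓝[Icc 0 1] (0 : ℝ), fderiv ℝ f (k s) (V s) = a + 2 * (s : ℂ) * b := by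
    filter_upwards [eventually_eventually_nhdsWithin.2 heq, hk, hdiff, eventually_mem_nhdsWithin]
      with s hs hks hfs hsI
    have h1 := hfs.hasFDerivAt.comp_hasDerivWithinAt s hks
    have h2 := (hpoly s).congr_of_eventuallyEq hs (hs.self_of_nhdsWithin hsI)
    exact (uniqueDiffOn_Icc zero_lt_one s hsI).eq_deriv _ h1 h2
  refine ⟨by simpa using hev.self_of_nhdsWithin h0, ?_⟩
  have hdf : DifferentiableAt ℝ (fderiv ℝ f) (k 0) :=
    (hf.fderiv_right (m := 1) (by norm_cast)).differentiableAt one_ne_zero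
  have h2 := (hdf.hasFDerivAt.comp_hasDerivWithinAt 0 hk0).clm_apply hV
  have h3 : HasDerivWithinAt (fun s : ℝ => a + 2 * (s : ℂ) * b) (2 * b) (Icc 0 1) 0 := by
    refine ((((hofReal 0).const_mul 2).mul_const b).const_add a).congr_deriv ?_
    simp
  have h4 := h3.congr_of_eventuallyEq hev (hev.self_of_nhdsWithin h0)
  exact (uniqueDiffOn_Icc zero_lt_one 0 h0).eq_deriv _ h2 h4

variable {d : ℕ} {M : Type*} [MetricSpace M] [ChartedSpace (Coord d) M] [IsManifold (𝓡 d) ∞ M]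
  [RiemannianBundle (fun x : M => TangentSpace (𝓡 d) x)]
  [IsContMDiffRiemannianBundle (𝓡 d) ∞ (Coord d) (fun x : M => TangentSpace (𝓡 d) x)]
  {e : OpenPartialHomeomorph M (Coord d)} {x z : M} {γ : ℝ → M} {s : ℝ}
  {ε : ℝ} {Φ : ℝ → Cotangent d M → Cotangent d M} {φ : ℝ → M → Cotangent d M → ℂ}

lemma IsLeviCivitaPhase.contDiffAt (hφ : IsLeviCivitaPhase ε Φ φ) (he : IsCoordSystem e)
    (t : ℝ) {p : Cotangent d M} (hp : p.2 ≠ 0) {u : Coord d} (hu : u ∈ e.target) :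
    ContDiffAt ℝ ∞ (fun u => φ t (e.symm u) p) u := by
  have h1 : ContMDiffAt (𝓡 d)
      (𝓘(ℝ, ℝ).prod ((𝓡 d).prod ((𝓡 d).prod 𝓘(ℝ, Coord d →L[ℝ] ℝ)))) ∞
      (fun u : Coord d => ((t, e.symm u, p) : ℝ × M × Cotangent d M)) u :=
    contMDiffAt_const.prodMk ((he.contMDiffAt_symm hu).prodMk contMDiffAt_const)
  have h2 := (hφ.smooth (t, e.symm u, p) hp).comp (s := univ) u h1.contMDiffWithinAt
    (fun _ _ => hp)
  exact (contMDiffWithinAt_univ.1 h2).contDiffAt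

variable [IsRiemannianManifold (𝓡 d) M]

/-- The phase function near `x*` in terms of initial velocities of shortest geodesics. -/
lemma IsLeviCivitaPhase.eventually_eq (hφ : IsLeviCivitaPhase ε Φ φ) (he : IsCoordSystem e)
    (t : ℝ) {p : Cotangent d M} (hp : p.2 ≠ 0) (hz : (Φ t p).1 ∈ e.source) :
    ∀ᶠ x in 𝓝 (Φ t p).1, (∃ γ : ℝ → M, IsShortestGeodesic (d := d) γ (Φ t p).1 x) ∧
      ∀ γ : ℝ → M, IsShortestGeodesic (d := d) γ (Φ t p).1 x →
        φ t x p = ((∑ α, components e (Φ t p) α *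
            derivWithin (fun r => e (γ r)) (Icc 0 1) 0 α : ℝ) : ℂ)
          + Complex.I * (ε : ℂ) / 2 * (hamiltonian p : ℂ) * ((dist (Φ t p).1 x : ℝ) : ℂ) ^ 2 := by
  obtain ⟨U, hU, hform⟩ := hφ.formula t p hp
  filter_upwards [hU.mem_nhds] with x hx
  obtain ⟨γ, ζ, hγ, huniq, hpar, hstart, hval⟩ := hform x hx
  refine ⟨⟨γ, hγ⟩, fun γ' hγ' => ?_⟩
  have h0 : (0 : ℝ) ∈ Icc (0 : ℝ) 1 := by simp
  have h1 : ∫ s in (0 : ℝ)..1, ζ s (velocity γ s) = ζ 0 (velocity γ 0) := by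
    have : ∫ s in (0 : ℝ)..1, ζ s (velocity γ s) = ∫ s in (0 : ℝ)..1, ζ 0 (velocity γ 0) := by
      refine intervalIntegral.integral_congr fun s hs => ?_
      rw [uIcc_of_le zero_le_one] at hs
      exact hpar.pairing_velocity hγ.isGeodesic hs
    rw [this]
    simp
  have hx0 : γ 0 ∈ e.source := by rwa [hγ.start]
  have h2 := pairing_eq_sum he (⟨γ 0, ζ 0⟩ : Cotangent d M) hx0 (velocity γ 0)
  rw [vecComponents_velocity hγ.isGeodesic.smooth h0 he hx0, congrArg (components e) hstart] at h2
  -- Uniqueness of the shortest geodesic transfers the formula to any other choice; rescaled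
  -- segments will be used in this way.
  have h3 : derivWithin (fun r => e (γ' r)) (Icc 0 1) 0 =
      derivWithin (fun r => e (γ r)) (Icc 0 1) 0 :=
    derivWithin_congr (fun r hr => by rw [huniq γ' hγ' hr]) (by rw [huniq γ' hγ' h0])
  rw [hval, h1, h3, dist_comm x]
  exact congrArg (fun r : ℝ => (r : ℂ) + _) h2

/-- The value of the phase function at `x*`. -/
lemma IsLeviCivitaPhase.apply_xStar (hφ : IsLeviCivitaPhase ε Φ φ)
    (t : ℝ) {p : Cotangent d M} (hp : p.2 ≠ 0) : φ t (Φ t p).1 p = 0 := by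
  set e := chartAt (Coord d) (Φ t p).1
  have he : IsCoordSystem e := IsManifold.chart_mem_maximalAtlas _
  have hz : (Φ t p).1 ∈ e.source := mem_chart_source _ _
  obtain ⟨⟨γ, hγ⟩, h⟩ := (hφ.eventually_eq he t hp hz).self_of_nhds
  have hx0 : γ 0 ∈ e.source := by rwa [hγ.start]
  have h1 := hγ.isGeodesic.metricForm_velocity (s := 0) (by simp) he hx0
  rw [hγ.norm_velocity, dist_self] at h1
  have h2 : derivWithin (fun r => e (γ r)) (Icc 0 1) 0 = 0 := by
    by_contra hne
    have := metricForm_pos he hx0 hne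
    rw [h1] at this
    simp at this
  rw [h γ hγ, h2, dist_self]
  simp

/-- The phase function along a shortest geodesic issuing from `x*`. -/
lemma IsLeviCivitaPhase.eventually_eq_along (hφ : IsLeviCivitaPhase ε Φ φ) (he : IsCoordSystem e)
    (t : ℝ) {p : Cotangent d M} (hp : p.2 ≠ 0) (hz : (Φ t p).1 ∈ e.source)
    (hγ : IsShortestGeodesic (d := d) γ (Φ t p).1 x) :
    ∀ᶠ s in 𝓝[Icc 0 1] (0 : ℝ), φ t (γ s) p =
      (s : ℂ) * ((∑ α, components e (Φ t p) α *
            derivWithin (fun r => e (γ r)) (Icc 0 1) 0 α : ℝ) : ℂ)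
          + (s : ℂ) ^ 2 * (Complex.I * (ε : ℂ) / 2 * (hamiltonian p : ℂ) *
            ((metricForm e (Φ t p).1 (derivWithin (fun r => e (γ r)) (Icc 0 1) 0) : ℝ) : ℂ)) := by
  have h0 : (0 : ℝ) ∈ Icc (0 : ℝ) 1 := by simp
  have hx0 : γ 0 ∈ e.source := by rwa [hγ.start]
  have hc : Filter.Tendsto γ (𝓝[Icc 0 1] (0 : ℝ)) (𝓝 (Φ t p).1) := by
    have := hγ.isGeodesic.smooth.continuousOn 0 h0
    rwa [ContinuousWithinAt, hγ.start] at this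
  filter_upwards [hc.eventually (hφ.eventually_eq he t hp hz), eventually_mem_nhdsWithin]
    with s hs hs1
  -- Rescaling a segment to `[0, 1]` needs `s > 0`; at `s = 0` the phase vanishes.
  rcases hs1.1.eq_or_lt with rfl | hpos
  · rw [hγ.start, hφ.apply_xStar t hp]
    simp
  have hs' : s ∈ Ioc (0 : ℝ) 1 := ⟨hpos, hs1.2⟩
  rw [hs.2 _ (hγ.comp_mul hs'), derivWithin_coord_comp_mul hγ.isGeodesic.smooth h0 he hs'
    (by rwa [mul_zero]), mul_zero, hγ.dist_eq hs1]
  have h1 := hγ.isGeodesic.metricForm_velocity h0 he hx0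
  rw [hγ.norm_velocity, hγ.start] at h1
  rw [h1]
  simp only [PiLp.smul_apply, smul_eq_mul]
  push_cast
  rw [Finset.mul_sum]
  congr 1
  · exact Finset.sum_congr rfl fun α _ => by ring
  · ring

lemma IsLeviCivitaPhase.fderiv_along (hφ : IsLeviCivitaPhase ε Φ φ) (he : IsCoordSystem e)
    (t : ℝ) {p : Cotangent d M} (hp : p.2 ≠ 0) (hz : (Φ t p).1 ∈ e.source)
    (hγ : IsShortestGeodesic (d := d) γ (Φ t p).1 x) {V : Coord d}
    (hV : derivWithin (fun r => e (γ r)) (Icc 0 1) 0 = V) :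
    fderiv ℝ (fun u => φ t (e.symm u) p) (e (Φ t p).1) V =
      ((∑ α, components e (Φ t p) α * V α : ℝ) : ℂ) ∧
    fderiv ℝ (fderiv ℝ (fun u => φ t (e.symm u) p)) (e (Φ t p).1) V V +
      fderiv ℝ (fun u => φ t (e.symm u) p) (e (Φ t p).1) (geodesicAccel e (Φ t p).1 V) =
      Complex.I * (ε : ℂ) * (hamiltonian p : ℂ) * ((metricForm e (Φ t p).1 V : ℝ) : ℂ) := by
  have h0 : (0 : ℝ) ∈ Icc (0 : ℝ) 1 := by simp
  have hx0 : γ 0 ∈ e.source := by rwa [hγ.start]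
  have hsrc := eventually_mem_source hγ.isGeodesic.smooth.continuousOn h0 hx0
  have h := fderiv_of_eq_along_curve (f := fun u => φ t (e.symm u) p) (k := fun r => e (γ r))
    (hφ.contDiffAt he t hp (e.map_source hx0))
    (hsrc.mono fun s hs => hasDerivWithinAt_coord hγ.isGeodesic.smooth hs.1 he hs.2)
    (hγ.isGeodesic.hasDerivWithinAt h0 he hx0)
    (by
      filter_upwards [hφ.eventually_eq_along he t hp hz hγ, hsrc] with s hs hs1
      simp only [e.left_inv hs1.2]
      exact hs)
  simp only [hV, hγ.start] at h
  refine ⟨h.1, h.2.trans ?_⟩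
  ring

/-- The differential of the phase function at `x*` is `ξ*`. -/
lemma IsLeviCivitaPhase.fderiv_xStar (hφ : IsLeviCivitaPhase ε Φ φ) (he : IsCoordSystem e)
    (t : ℝ) {p : Cotangent d M} (hp : p.2 ≠ 0) (hz : (Φ t p).1 ∈ e.source) (v : Coord d) :
    fderiv ℝ (fun u => φ t (e.symm u) p) (e (Φ t p).1) v =
      ((∑ α, components e (Φ t p) α * v α : ℝ) : ℂ) := by
  refine mem_cone_of_initial_velocities he hz (K := {v | fderiv ℝ (fun u => φ t (e.symm u) p)
    (e (Φ t p).1) v = ((∑ α, components e (Φ t p) α * v α : ℝ) : ℂ)}) ?_ ?_ ?_ v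
  · refine isClosed_eq (by fun_prop) (by fun_prop)
  · intro c _ w hw
    simp only [mem_ofPred_eq, map_smul] at hw ⊢
    rw [hw, Complex.real_smul, ← Complex.ofReal_mul, Finset.mul_sum]
    congr 1
    refine Finset.sum_congr rfl fun α _ => ?_
    simp only [PiLp.smul_apply, smul_eq_mul]
    ring
  · filter_upwards [hφ.eventually_eq he t hp hz] with x hx
    obtain ⟨γ, hγ⟩ := hx.1
    exact ⟨γ, hγ, (hφ.fderiv_along he t hp hz hγ rfl).1⟩

/-- The second derivative of the phase function at `x*`. -/
lemma IsLeviCivitaPhase.fderiv_fderiv_xStar (hφ : IsLeviCivitaPhase ε Φ φ) (he : IsCoordSystem e)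
    (t : ℝ) {p : Cotangent d M} (hp : p.2 ≠ 0) (hz : (Φ t p).1 ∈ e.source) (v w : Coord d) :
    fderiv ℝ (fderiv ℝ (fun u => φ t (e.symm u) p)) (e (Φ t p).1) v w =
      ∑ α, ∑ ν, (((∑ μ, christoffel e (Φ t p).1 μ α ν * components e (Φ t p) μ : ℝ) : ℂ) +
        Complex.I * (ε : ℂ) * (hamiltonian p : ℂ) * (metricMatrix e (Φ t p).1 α ν : ℂ)) *
        (v α : ℂ) * (w ν : ℂ) := by
  set f := fun u => φ t (e.symm u) p with hf
  set S : Fin d → Fin d → ℂ := fun α ν =>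
    (((∑ μ, christoffel e (Φ t p).1 μ α ν * components e (Φ t p) μ : ℝ) : ℂ) +
        Complex.I * (ε : ℂ) * (hamiltonian p : ℂ) * (metricMatrix e (Φ t p).1 α ν : ℂ)) with hS
  refine bilin_eq_sum_of_diag _ ?_ S ?_ ?_ v w
  · have := (hφ.contDiffAt he t hp (e.map_source hz)).isSymmSndFDerivAt (by simp; norm_cast)
    exact fun v w => this v w
  · intro α β
    simp only [hS]
    rw [metricMatrix_comm]
    simp_rw [christoffel_comm _ _ α β]
  intro v
  refine mem_cone_of_initial_velocities he hz (K := {v | fderiv ℝ (fderiv ℝ f) (e (Φ t p).1) v v =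
    ∑ α, ∑ β, S α β * (v α : ℂ) * (v β : ℂ)}) ?_ ?_ ?_ v
  · refine isClosed_eq (by fun_prop) (by fun_prop)
  · intro c _ w hw
    simp only [mem_ofPred_eq, map_smul, smul_apply] at hw ⊢
    rw [hw, Complex.real_smul, Complex.real_smul]
    simp_rw [Finset.mul_sum]
    refine Finset.sum_congr rfl fun α _ => Finset.sum_congr rfl fun β _ => ?_
    simp only [PiLp.smul_apply, smul_eq_mul, Complex.ofReal_mul]
    ring
  · filter_upwards [hφ.eventually_eq he t hp hz] with x hx
    obtain ⟨γ, hγ⟩ := hx.1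
    refine ⟨γ, hγ, ?_⟩
    have h := (hφ.fderiv_along he t hp hz hγ rfl).2
    -- The first derivative, already known on all vectors, evaluates the acceleration term as
    -- `-Γ^μ_{αν} ξ*_μ V^α V^ν`.
    rw [hφ.fderiv_xStar he t hp hz] at h
    set V := derivWithin (fun r => e (γ r)) (Icc 0 1) 0
    refine (eq_sub_of_add_eq h).trans ?_
    simp only [hS, metricForm, geodesicAccel, Finset.mul_sum, mul_neg, Finset.sum_neg_distrib,
      Complex.ofReal_neg, sub_neg_eq_add, add_mul, Finset.sum_add_distrib, Complex.ofReal_sum,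
      Complex.ofReal_mul, Finset.sum_mul]
    rw [add_comm]
    congr 1
    · rw [Finset.sum_comm]
      refine Finset.sum_congr rfl fun α _ => ?_
      rw [Finset.sum_comm]
      exact Finset.sum_congr rfl fun β _ => Finset.sum_congr rfl fun μ _ => by ring
    · exact Finset.sum_congr rfl fun α _ => Finset.sum_congr rfl fun β _ => by ring

end

/-! ### Nondegenerate critical points depending on parameters -/

section

section Partial

variable {E₁ E₂ F : Type*} [NormedAddCommGroup E₁] [NormedSpace ℝ E₁]
  [NormedAddCommGroup E₂] [NormedSpace ℝ E₂] [NormedAddCommGroup F] [NormedSpace ℝ F]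

lemma fderiv_right_eq_comp_inr {P : E₁ × E₂ → F} {p : E₁ × E₂} (h : DifferentiableAt ℝ P p) :
    fderiv ℝ (fun u => P (p.1, u)) p.2 = (fderiv ℝ P p).comp (ContinuousLinearMap.inr ℝ E₁ E₂) :=
  (HasFDerivAt.comp p.2 (f := fun u => (p.1, u)) (g := P) h.hasFDerivAt
    (hasFDerivAt_prodMk_right p.1 p.2)).fderiv

lemma contDiffAt_fderiv_right {P : E₁ × E₂ → F} {p : E₁ × E₂} (h : ContDiffAt ℝ ∞ P p) :
    ContDiffAt ℝ 1 (fun p => fderiv ℝ (fun u => P (p.1, u)) p.2) p := by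
  have h1 : ContDiffAt ℝ 1 (fun p => (fderiv ℝ P p).comp (ContinuousLinearMap.inr ℝ E₁ E₂)) p :=
    (h.fderiv_right (m := 1) (by norm_cast)).clm_comp contDiffAt_const
  refine h1.congr_of_eventuallyEq ?_
  filter_upwards [(h.of_le (m := 1) (by norm_cast)).eventually (by simp)] with q hq
  exact fderiv_right_eq_comp_inr (hq.differentiableAt one_ne_zero)

/-- A vector in the kernel would annihilate the quadratic form, so the map is injective, and a
finite-dimensional space and its dual have equal dimension. -/
lemma isInvertible_of_form_ne_zero {d : ℕ} (B : Coord d →L[ℝ] Coord d →L[ℝ] ℝ)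
    (hB : ∀ v, v ≠ 0 → B v v ≠ 0) : B.IsInvertible := by
  have hinj : Function.Injective (B : Coord d →ₗ[ℝ] Coord d →L[ℝ] ℝ) := by
    rw [injective_iff_map_eq_zero]
    intro v hv
    by_contra h
    apply hB v h
    change (B : Coord d →ₗ[ℝ] Coord d →L[ℝ] ℝ) v v = 0
    rw [hv]
    rfl
  have hdim : Module.finrank ℝ (Coord d) = Module.finrank ℝ (Coord d →L[ℝ] ℝ) := by
    rw [← (LinearMap.toContinuousLinearMap (𝕜 := ℝ) (E := Coord d) (F' := ℝ)).finrank_eq]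
    exact Subspace.dual_finrank_eq.symm
  exact ⟨(LinearMap.linearEquivOfInjective _ hinj hdim).toContinuousLinearEquiv, rfl⟩

/-- Nondegenerate critical points of the imaginary part depend differentiably on parameters. -/
lemma exists_critical_point_function {d : ℕ} [CompleteSpace E₁] {P : E₁ × Coord d → ℂ} {a₀ : E₁}
    {u₀ : Coord d} (hP : ContDiffAt ℝ ∞ P (a₀, u₀))
    (hcrit : ∀ v, (fderiv ℝ (fun u => P (a₀, u)) u₀ v).im = 0)
    (hnd : ∀ v, v ≠ 0 → (fderiv ℝ (fderiv ℝ (fun u => P (a₀, u))) u₀ v v).im ≠ 0) :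
    ∃ X : E₁ → Coord d, X a₀ = u₀ ∧ DifferentiableAt ℝ X a₀ ∧
      (∀ᶠ a in 𝓝 a₀, ContinuousAt X a) ∧
      ∀ᶠ p in 𝓝 (a₀, u₀), (∀ v, (fderiv ℝ (fun u => P (p.1, u)) p.2 v).im = 0) → p.2 = X p.1 := by
  set D : E₁ × Coord d → Coord d →L[ℝ] ℂ := fun p => fderiv ℝ (fun u => P (p.1, u)) p.2 with hD
  -- Taking imaginary parts turns the critical point condition into an equation with values in the
  -- real dual, of the same dimension as the unknown, as the implicit function theorem requires.
  set L : (Coord d →L[ℝ] ℂ) →L[ℝ] Coord d →L[ℝ] ℝ :=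
    ContinuousLinearMap.compL ℝ (Coord d) ℂ ℝ Complex.imCLM with hL
  have hDc : ContDiffAt ℝ 1 D (a₀, u₀) := contDiffAt_fderiv_right hP
  have hF : HasStrictFDerivAt (fun p => L (D p)) (L.comp (fderiv ℝ D (a₀, u₀))) (a₀, u₀) :=
    L.hasStrictFDerivAt.comp _ (hDc.hasStrictFDerivAt one_ne_zero)
  have hF0 : L (D (a₀, u₀)) = 0 := by
    ext v
    exact hcrit v
  have hpart := fderiv_right_eq_comp_inr (hDc.differentiableAt one_ne_zero)
  have hinv : ((L.comp (fderiv ℝ D (a₀, u₀))).comp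
      (ContinuousLinearMap.inr ℝ E₁ (Coord d))).IsInvertible := by
    refine isInvertible_of_form_ne_zero _ fun v hv => ?_
    rw [ContinuousLinearMap.comp_assoc, ← hpart]
    exact hnd v hv
  have hiff := hF.eventually_apply_eq_iff_implicitFunctionOfProdDomain hinv
  have hX := hF.hasStrictFDerivAt_implicitFunctionOfProdDomain hinv
  refine ⟨hF.implicitFunctionOfProdDomain hinv, (hiff.self_of_nhds.1 rfl), hX.differentiableAt,
    ?_, ?_⟩
  -- Strict differentiability at `a₀` gives a Lipschitz bound on a neighbourhood, hence continuity
  -- at every nearby point.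
  · obtain ⟨K, s, hs, hlip⟩ := hX.exists_lipschitzOnWith
    filter_upwards [eventually_mem_nhds_iff.2 hs] with a ha
    exact hlip.continuousOn.continuousAt ha
  · filter_upwards [hiff] with p hp hcr
    refine (hp.1 ?_).symm
    rw [hF0]
    ext v
    exact hcr v

end Partial

/-! ### Regularity of the base trajectories in the initial covector -/

variable {d : ℕ} {M : Type*} [MetricSpace M] [ChartedSpace (Coord d) M] [IsManifold (𝓡 d) ∞ M]
  {e ey : OpenPartialHomeomorph M (Coord d)} {y : M}

/-- With the base point fixed, the map is linear into one fibre, hence smooth in a trivialization.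
-/
lemma contMDiff_covec (ey : OpenPartialHomeomorph M (Coord d)) (y : M) :
    ContMDiff 𝓘(ℝ, Coord d) ((𝓡 d).prod 𝓘(ℝ, Coord d →L[ℝ] ℝ)) ∞
      (fun q : Coord d => (⟨y, covec ey y q⟩ : Cotangent d M)) := by
  intro q₀
  rw [contMDiffAt_totalSpace]
  refine ⟨contMDiffAt_const, ?_⟩
  set T := trivializationAt (Coord d →L[ℝ] ℝ) (fun x : M => TangentSpace (𝓡 d) x →L[ℝ] ℝ) y
  have hy : y ∈ T.baseSet := mem_baseSet_trivializationAt _ _ y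
  let L₀ : Coord d →ₗ[ℝ] (TangentSpace (𝓡 d) y →L[ℝ] ℝ) :=
    { toFun := covec ey y
      map_add' := fun q q' => by simp [covec, add_smul, Finset.sum_add_distrib]
      map_smul' := fun c q => by simp [covec, Finset.smul_sum, smul_smul] }
  let L : Coord d →ₗ[ℝ] (Coord d →L[ℝ] ℝ) := T.linearMapAt ℝ y ∘ₗ L₀
  have h : ContDiff ℝ ∞ L := (LinearMap.toContinuousLinearMap L).contDiff
  refine (h.contDiffAt.contMDiffAt (x := q₀)).congr_of_eventuallyEq
    (Filter.Eventually.of_forall fun q => ?_)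
  change _ = T.linearMapAt ℝ y (covec ey y q)
  rw [T.coe_linearMapAt_of_mem hy]

variable [RiemannianBundle (fun x : M => TangentSpace (𝓡 d) x)]
  [IsContMDiffRiemannianBundle (𝓡 d) ∞ (Coord d) (fun x : M => TangentSpace (𝓡 d) x)]
  {ε : ℝ} {Φ : ℝ → Cotangent d M → Cotangent d M} {φ : ℝ → M → Cotangent d M → ℂ}

/-- The phase function in local coordinates is smooth in all its variables. -/
lemma IsLeviCivitaPhase.contDiffAt_joint (hφ : IsLeviCivitaPhase ε Φ φ) (he : IsCoordSystem e)
    (hey : IsCoordSystem ey) (hy : y ∈ ey.source) (t : ℝ) {q u : Coord d} (hq : q ≠ 0)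
    (hu : u ∈ e.target) :
    ContDiffAt ℝ ∞ (fun p : (ℝ × Coord d) × Coord d =>
      φ p.1.1 (e.symm p.2) ⟨y, covec ey y p.1.2⟩) ((t, q), u) := by
  have h1 : ContMDiffAt 𝓘(ℝ, (ℝ × Coord d) × Coord d)
      (𝓘(ℝ, ℝ).prod ((𝓡 d).prod ((𝓡 d).prod 𝓘(ℝ, Coord d →L[ℝ] ℝ)))) ∞
      (fun p : (ℝ × Coord d) × Coord d =>
        ((p.1.1, e.symm p.2, ⟨y, covec ey y p.1.2⟩) : ℝ × M × Cotangent d M)) ((t, q), u) := by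
    have ht : ContDiff ℝ ∞ (fun p : (ℝ × Coord d) × Coord d => p.1.1) := by fun_prop
    have hq : ContDiff ℝ ∞ (fun p : (ℝ × Coord d) × Coord d => p.1.2) := by fun_prop
    have hu' : ContDiff ℝ ∞ (fun p : (ℝ × Coord d) × Coord d => p.2) := by fun_prop
    refine ht.contMDiff.contMDiffAt.prodMk (ContMDiffAt.prodMk ?_ ?_)
    · exact ContMDiffAt.comp (g := e.symm) (f := fun p : (ℝ × Coord d) × Coord d => p.2)
        ((t, q), u) (he.contMDiffAt_symm hu) hu'.contMDiff.contMDiffAt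
    · exact (contMDiff_covec ey y).contMDiffAt.comp ((t, q), u) hq.contMDiff.contMDiffAt
  have hopen : {p : (ℝ × Coord d) × Coord d | p.1.2 ≠ 0} ∈ 𝓝 ((t, q), u) :=
    (isOpen_ne_fun (by fun_prop) continuous_const).mem_nhds hq
  have h2 := (hφ.smooth (t, e.symm u, ⟨y, covec ey y q⟩) (covec_ne_zero hey hy hq)).comp
    (s := {p : (ℝ × Coord d) × Coord d | p.1.2 ≠ 0}) ((t, q), u) h1.contMDiffWithinAt
    (fun p hp => covec_ne_zero hey hy hp)
  exact (h2.contMDiffAt hopen).contDiffAt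

variable [IsRiemannianManifold (𝓡 d) M]

/-- Near a given trajectory, and as long as it stays close to it at one time, the base trajectory
is the implicitly defined critical point of the imaginary part of the phase function. -/
lemma exists_local_description (hΦ : IsHamiltonianFlow hamiltonian Φ) (hε : 0 < ε)
    (hφ : IsLeviCivitaPhase ε Φ φ) (he : IsCoordSystem e)
    (hey : IsCoordSystem ey) (hy : y ∈ ey.source) (t₀ : ℝ) {q₀ : Coord d} (hq₀ : q₀ ≠ 0)
    (hx : (Φ t₀ ⟨y, covec ey y q₀⟩).1 ∈ e.source) :
    ∃ X : ℝ × Coord d → Coord d, DifferentiableAt ℝ X (t₀, q₀) ∧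
      ∃ δ > 0, ∀ t₁ ∈ Metric.ball t₀ δ,
        ContinuousAt (fun q => (Φ t₁ ⟨y, covec ey y q⟩).1) q₀ → ∀ t ∈ Metric.ball t₀ δ,
          ContinuousAt (fun q => (Φ t ⟨y, covec ey y q⟩).1) q₀ ∧
          ∀ᶠ q in 𝓝 q₀, e (Φ t ⟨y, covec ey y q⟩).1 = X (t, q) := by
  set c : ℝ → Coord d → M := fun t q => (Φ t ⟨y, covec ey y q⟩).1 with hc
  have hcov : ∀ q : Coord d, q ≠ 0 → (⟨y, covec ey y q⟩ : Cotangent d M).2 ≠ 0 :=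
    fun q hq => covec_ne_zero hey hy hq
  have hcc : ∀ q : Coord d, q ≠ 0 → Continuous fun t => c t q :=
    fun q hq => hΦ.continuous_base _ (hcov q hq)
  set u₀ := e (c t₀ q₀) with hu₀
  have hu₀t : u₀ ∈ e.target := e.map_source hx
  have hcrit : ∀ t q, q ≠ 0 → c t q ∈ e.source → ∀ v,
      (fderiv ℝ (fun u => φ t (e.symm u) ⟨y, covec ey y q⟩) (e (c t q)) v).im = 0 := by
    intro t q hq hs v
    rw [hφ.fderiv_xStar he t (hcov q hq) hs, Complex.ofReal_im]
  have hnd : ∀ v : Coord d, v ≠ 0 →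
      (fderiv ℝ (fderiv ℝ (fun u => φ t₀ (e.symm u) ⟨y, covec ey y q₀⟩)) u₀ v v).im ≠ 0 := by
    intro v hv
    -- The Christoffel part of the Hessian is real, so only the metric part contributes to the
    -- imaginary part.
    have h1 : (fderiv ℝ (fderiv ℝ (fun u => φ t₀ (e.symm u) ⟨y, covec ey y q₀⟩)) u₀ v v).im =
        ε * hamiltonian (⟨y, covec ey y q₀⟩ : Cotangent d M) * metricForm e (c t₀ q₀) v := by
      rw [hφ.fderiv_fderiv_xStar he t₀ (hcov q₀ hq₀) hx, metricForm, Finset.mul_sum, Complex.im_sum]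
      refine Finset.sum_congr rfl fun α _ => ?_
      rw [Finset.mul_sum, Complex.im_sum]
      refine Finset.sum_congr rfl fun β _ => ?_
      simp [-Complex.ofReal_sum, hc]
      ring
    rw [h1]
    exact (mul_pos (mul_pos hε (hamiltonian_pos (hcov q₀ hq₀))) (metricForm_pos he hx hv)).ne'
  -- Time is included among the parameters, so one function `X` and one neighbourhood serve all
  -- nearby times.
  obtain ⟨X, hX0, hXd, hXc, hXu⟩ := exists_critical_point_function
    (hφ.contDiffAt_joint he hey hy t₀ hq₀ hu₀t) (hcrit t₀ q₀ hq₀ hx) hnd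
  refine ⟨X, hXd, ?_⟩
  obtain ⟨δ₁, hδ₁, hB₁⟩ : ∃ δ₁ > 0, ∀ p ∈ Metric.ball ((t₀, q₀), u₀) δ₁,
      ((∀ v, (fderiv ℝ (fun u => φ p.1.1 (e.symm u) ⟨y, covec ey y p.1.2⟩) p.2 v).im = 0) →
        p.2 = X p.1) ∧ p.2 ∈ e.target :=
    Metric.eventually_nhds_iff_ball.1
      (hXu.and (continuousAt_snd.eventually (e.open_target.mem_nhds hu₀t)))
  have hball : ∀ u ∈ Metric.ball u₀ δ₁, u ∈ e.target := by
    intro u hu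
    refine (hB₁ ((t₀, q₀), u) ?_).2
    simpa [Prod.dist_eq, hδ₁] using hu
  set W := e.source ∩ e ⁻¹' Metric.ball u₀ δ₁ with hW
  have hWo : IsOpen W := e.isOpen_inter_preimage Metric.isOpen_ball
  -- `K` is a closed set inside the open set `W`. Since `X` takes values in the half-radius ball, a
  -- trajectory point in `W` is the critical point `X (t, q)` and so already lies in `K`.
  set K := e.symm '' Metric.closedBall u₀ (δ₁ / 2) with hK
  have hKc : IsClosed K := by
    refine ((isCompact_closedBall u₀ (δ₁ / 2)).image_of_continuousOn ?_).isClosed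
    exact e.continuousOn_symm.mono fun u hu =>
      hball u (Metric.closedBall_subset_ball (half_lt_self hδ₁) hu)
  have hKW : K ⊆ W := by
    rintro _ ⟨u, hu, rfl⟩
    have hu' := Metric.closedBall_subset_ball (half_lt_self hδ₁) hu
    refine ⟨e.map_target (hball u hu'), ?_⟩
    rw [mem_preimage, e.right_inv (hball u hu')]
    exact hu'
  obtain ⟨δ₂, hδ₂, hB₂⟩ : ∃ δ₂ > 0, ∀ a ∈ Metric.ball (t₀, q₀) δ₂,
      X a ∈ Metric.ball u₀ (δ₁ / 2) ∧ ContinuousAt X a ∧ a.2 ≠ 0 ∧ c a.1 q₀ ∈ W := by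
    refine Metric.eventually_nhds_iff_ball.1 ?_
    have h1 := hXd.continuousAt.eventually_mem
      (Metric.ball_mem_nhds (X (t₀, q₀)) (half_pos hδ₁))
    rw [hX0] at h1
    have h2 : ∀ᶠ a : ℝ × Coord d in 𝓝 (t₀, q₀), a.2 ≠ 0 :=
      continuousAt_snd.eventually_ne hq₀
    have h3 : ∀ᶠ a : ℝ × Coord d in 𝓝 (t₀, q₀), c a.1 q₀ ∈ W := by
      have h4 : ContinuousAt (fun a : ℝ × Coord d => c a.1 q₀) (t₀, q₀) :=
        ((hcc q₀ hq₀).comp continuous_fst).continuousAt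
      exact h4.eventually_mem (hWo.mem_nhds ⟨hx, Metric.mem_ball_self hδ₁⟩)
    exact h1.and (hXc.and (h2.and h3))
  set δ := min δ₁ δ₂ with hδ
  have hδ0 : 0 < δ := lt_min hδ₁ hδ₂
  have hmem : ∀ t ∈ Metric.ball t₀ δ, ∀ q ∈ Metric.ball q₀ δ, (t, q) ∈ Metric.ball (t₀, q₀) δ₂ := by
    intro t ht q hq
    rw [Metric.mem_ball] at ht hq
    rw [Metric.mem_ball, Prod.dist_eq]
    exact max_lt (ht.trans_le (min_le_right _ _)) (hq.trans_le (min_le_right _ _))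
  have hXW : ∀ t ∈ Metric.ball t₀ δ, ∀ q ∈ Metric.ball q₀ δ, c t q ∈ W →
      e (c t q) = X (t, q) ∧ c t q ∈ K := by
    intro t ht q hq hcW
    have h2 := hB₂ _ (hmem t ht q hq)
    have h3 : ((t, q), e (c t q)) ∈ Metric.ball ((t₀, q₀), u₀) δ₁ := by
      have hcW2 : dist (e (c t q)) u₀ < δ₁ := hcW.2
      rw [Metric.mem_ball] at ht hq
      rw [Metric.mem_ball, Prod.dist_eq, Prod.dist_eq]
      exact max_lt (max_lt (ht.trans_le (min_le_left _ _)) (hq.trans_le (min_le_left _ _))) hcW2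
    have h4 : e (c t q) = X (t, q) := (hB₁ _ h3).1 (hcrit t q h2.2.2.1 hcW.1)
    refine ⟨h4, e (c t q), ?_, e.left_inv hcW.1⟩
    rw [h4]
    exact Metric.ball_subset_closedBall h2.1
  have hprop : ∀ q ∈ Metric.ball q₀ δ, ∀ t₁ ∈ Metric.ball t₀ δ, c t₁ q ∈ W →
      ∀ t ∈ Metric.ball t₀ δ, c t q ∈ W := by
    intro q hq t₁ ht₁ hW₁ t ht
    by_contra hcon
    have hq0 : q ≠ 0 := (hB₂ _ (hmem t ht q hq)).2.2.1
    have hpre : IsPreconnected ((fun t => c t q) '' Metric.ball t₀ δ) :=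
      (convex_ball t₀ δ).isPreconnected.image _ (hcc q hq0).continuousOn
    -- A trajectory that meets `W` and also leaves it would be covered by the open sets `W` and
    -- `Kᶜ`; being connected it would have a point in `W` outside `K`.
    obtain ⟨_, ⟨s, hs, rfl⟩, hsW, hsK⟩ := hpre W Kᶜ hWo hKc.isOpen_compl
      (fun x _ => (em (x ∈ K)).imp (fun h => hKW h) id)
      ⟨_, ⟨t₁, ht₁, rfl⟩, hW₁⟩ ⟨_, ⟨t, ht, rfl⟩, fun h => hcon (hKW h)⟩
    exact hsK (hXW s hs q hq hsW).2
  refine ⟨δ, hδ0, fun t₁ ht₁ hcont t ht => ?_⟩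
  have hq₀mem : q₀ ∈ Metric.ball q₀ δ := Metric.mem_ball_self hδ0
  have hev : ∀ᶠ q in 𝓝 q₀, c t q ∈ W ∧ e (c t q) = X (t, q) := by
    -- Continuity at the one time `t₁` puts nearby trajectories in `W` at `t₁`, and `hprop` keeps
    -- them there throughout the time interval.
    filter_upwards [hcont.eventually_mem (hWo.mem_nhds (hB₂ _ (hmem t₁ ht₁ q₀ hq₀mem)).2.2.2),
      Metric.ball_mem_nhds q₀ hδ0] with q hq hqδ
    have := hprop q hqδ t₁ ht₁ hq t ht
    exact ⟨this, (hXW t ht q hqδ this).1⟩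
  refine ⟨?_, hev.mono fun q hq => hq.2⟩
  have hXt : ContinuousAt (fun q => X (t, q)) q₀ :=
    ContinuousAt.comp (g := X) (f := fun q => (t, q)) (hB₂ _ (hmem t ht q₀ hq₀mem)).2.1
      (by fun_prop)
  have hX0t : X (t, q₀) ∈ e.target := by
    rw [← hev.self_of_nhds.2]
    exact e.map_source hev.self_of_nhds.1.1
  have h5 : ContinuousAt (fun q => e.symm (X (t, q))) q₀ :=
    ContinuousAt.comp (g := e.symm) (f := fun q => X (t, q)) (e.continuousAt_symm hX0t) hXt
  refine h5.congr ?_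
  filter_upwards [hev] with q hq
  rw [← hq.2, e.left_inv hq.1.1]

/-- The base trajectories depend continuously on the initial covector. -/
lemma continuousAt_flow (hΦ : IsHamiltonianFlow hamiltonian Φ) (hε : 0 < ε)
    (hφ : IsLeviCivitaPhase ε Φ φ) (hey : IsCoordSystem ey) (hy : y ∈ ey.source) (t : ℝ)
    {q₀ : Coord d} (hq₀ : q₀ ≠ 0) :
    ContinuousAt (fun q => (Φ t ⟨y, covec ey y q⟩).1) q₀ := by
  set S := {t | ContinuousAt (fun q => (Φ t ⟨y, covec ey y q⟩).1) q₀} with hS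
  -- Around every time, either all nearby times belong to `S` or none do; hence `S` is both open and
  -- closed in `ℝ`.
  have hloc : ∀ t₀, ∃ δ > 0, ∀ t₁ ∈ Metric.ball t₀ δ, t₁ ∈ S → ∀ t ∈ Metric.ball t₀ δ, t ∈ S := by
    intro t₀
    obtain ⟨X, -, δ, hδ, h⟩ := exists_local_description hΦ hε hφ
      (e := chartAt (Coord d) (Φ t₀ ⟨y, covec ey y q₀⟩).1)
      (IsManifold.chart_mem_maximalAtlas _) hey hy t₀ hq₀ (mem_chart_source _ _)
    exact ⟨δ, hδ, fun t₁ ht₁ hS₁ t ht => (h t₁ ht₁ hS₁ t ht).1⟩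
  have hopen : IsOpen S := by
    rw [Metric.isOpen_iff]
    intro t₀ ht₀
    obtain ⟨δ, hδ, h⟩ := hloc t₀
    exact ⟨δ, hδ, fun t ht => h t₀ (Metric.mem_ball_self hδ) ht₀ t ht⟩
  have hclosed : IsClosed S := by
    rw [← closure_subset_iff_isClosed]
    intro t₀ ht₀
    obtain ⟨δ, hδ, h⟩ := hloc t₀
    obtain ⟨t₁, ht₁, hd⟩ := Metric.mem_closure_iff.1 ht₀ δ hδ
    exact h t₁ (by rwa [Metric.mem_ball, dist_comm]) ht₁ t₀ (Metric.mem_ball_self hδ)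
  have h0 : (0 : ℝ) ∈ S := by
    have : (fun _ : Coord d => y) =ᶠ[𝓝 q₀] fun q => (Φ 0 ⟨y, covec ey y q⟩).1 := by
      filter_upwards [isOpen_ne.mem_nhds hq₀] with q hq
      rw [hΦ.initial _ (covec_ne_zero hey hy hq)]
    exact continuousAt_const.congr this
  have : S = univ := IsClopen.eq_univ ⟨hclosed, hopen⟩ ⟨0, h0⟩
  have ht : t ∈ S := this ▸ mem_univ t
  exact ht

lemma differentiableAt_xStar (hΦ : IsHamiltonianFlow hamiltonian Φ) (hε : 0 < ε)
    (hφ : IsLeviCivitaPhase ε Φ φ) (he : IsCoordSystem e) (hey : IsCoordSystem ey)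
    (hy : y ∈ ey.source) (t : ℝ) {q₀ : Coord d} (hq₀ : q₀ ≠ 0)
    (hx : (Φ t ⟨y, covec ey y q₀⟩).1 ∈ e.source) :
    DifferentiableAt ℝ (xStar Φ e ey t y) q₀ := by
  obtain ⟨X, hX, δ, hδ, h⟩ := exists_local_description hΦ hε hφ he hey hy t hq₀ hx
  have h1 := (h t (Metric.mem_ball_self hδ) (continuousAt_flow hΦ hε hφ hey hy t hq₀) t
    (Metric.mem_ball_self hδ)).2
  have h2 : DifferentiableAt ℝ (fun q => X (t, q)) q₀ :=
    DifferentiableAt.comp (g := X) (f := fun q => (t, q)) q₀ hX (by fun_prop)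
  exact h2.congr_of_eventuallyEq h1

end

end LeviCivitaPhase

end

/-! ### The mixed Hessian -/

open LeviCivitaPhase

theorem theorem4p3 {d : ℕ} (hd : 2 ≤ d)
    {M : Type*} [MetricSpace M] [CompactSpace M] [ConnectedSpace M]
    [ChartedSpace (Coord d) M] [IsManifold (𝓡 d) ∞ M]
    [RiemannianBundle (fun x : M => TangentSpace (𝓡 d) x)]
    [IsContMDiffRiemannianBundle (𝓡 d) ∞ (Coord d) (fun x : M => TangentSpace (𝓡 d) x)]
    [IsRiemannianManifold (𝓡 d) M]
    (Φ : ℝ → Cotangent d M → Cotangent d M) (hΦ : IsHamiltonianFlow hamiltonian Φ)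
    (ε : ℝ) (hε : 0 < ε)
    (φ : ℝ → M → Cotangent d M → ℂ) (hφ : IsLeviCivitaPhase ε Φ φ)
    -- arbitrary local coordinates near `x*` and near `y`
    (ex ey : OpenPartialHomeomorph M (Coord d)) (hex : IsCoordSystem ex) (hey : IsCoordSystem ey)
    (t : ℝ) (y : M) (hy : y ∈ ey.source)
    -- the components of a covector `η ≠ 0` at `y`
    (η : Coord d) (hη : η ≠ 0)
    (hx : (Φ t ⟨y, covec ey y η⟩).1 ∈ ex.source) :
    DifferentiableAt ℝ (xStar Φ ex ey t y) η ∧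
    DifferentiableAt ℝ (xiStar Φ ex ey t y) η ∧
    ∀ α β : Fin d,
      mixedHessian φ ex ey t y (xStar Φ ex ey t y η) η α β
        = ((pderiv (fun q => xiStar Φ ex ey t y q α) η β : ℝ) : ℂ)
          - ((∑ μ, ∑ ν, christoffel ex (Φ t ⟨y, covec ey y η⟩).1 μ α ν * xiStar Φ ex ey t y η μ
              * pderiv (fun q => xStar Φ ex ey t y q ν) η β : ℝ) : ℂ)
          - Complex.I * (ε : ℂ) * ((hamiltonian (⟨y, covec ey y η⟩ : Cotangent d M) : ℝ) : ℂ)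
              * ((∑ ν, metricMatrix ex (Φ t ⟨y, covec ey y η⟩).1 α ν
                * pderiv (fun q => xStar Φ ex ey t y q ν) η β : ℝ) : ℂ) := by
  set p : Cotangent d M := ⟨y, covec ey y η⟩ with hp
  have hp0 : p.2 ≠ 0 := covec_ne_zero hey hy hη
  have hxd : DifferentiableAt ℝ (xStar Φ ex ey t y) η :=
    differentiableAt_xStar hΦ hε hφ hex hey hy t hη hx
  set P : (ℝ × Coord d) × Coord d → ℂ := fun p =>
    φ p.1.1 (ex.symm p.2) ⟨y, covec ey y p.1.2⟩ with hP
  set u₀ := xStar Φ ex ey t y η with hu₀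
  have hPc : ContDiffAt ℝ ∞ P ((t, η), u₀) :=
    hφ.contDiffAt_joint hex hey hy t hη (ex.map_source hx)
  set D : (ℝ × Coord d) × Coord d → Coord d →L[ℝ] ℂ :=
    fun p => fderiv ℝ (fun u => P (p.1, u)) p.2 with hD
  have hDd : DifferentiableAt ℝ D ((t, η), u₀) :=
    (contDiffAt_fderiv_right hPc).differentiableAt one_ne_zero
  -- The identity `φ_x = ξ*` at `x*` for all `q` near `η`; continuity of the flow keeps `x*` in the
  -- chart.
  have hev : ∀ᶠ q in 𝓝 η, ∀ v, D ((t, q), xStar Φ ex ey t y q) v =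
      ((∑ α, xiStar Φ ex ey t y q α * v α : ℝ) : ℂ) := by
    filter_upwards [(continuousAt_flow hΦ hε hφ hey hy t hη).eventually_mem
      (ex.open_source.mem_nhds hx), isOpen_ne.mem_nhds hη] with q hq hq0 v
    exact hφ.fderiv_xStar hex t (covec_ne_zero hey hy hq0) hq v
  have hcurve : HasFDerivAt (fun q => (((t, q), xStar Φ ex ey t y q) : (ℝ × Coord d) × Coord d))
      ((ContinuousLinearMap.inr ℝ ℝ (Coord d)).prod (fderiv ℝ (xStar Φ ex ey t y) η)) η :=
    (hasFDerivAt_prodMk_right t η).prodMk hxd.hasFDerivAt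
  have hcomp : HasFDerivAt (fun q => D ((t, q), xStar Φ ex ey t y q))
      ((fderiv ℝ D ((t, η), u₀)).comp
        ((ContinuousLinearMap.inr ℝ ℝ (Coord d)).prod (fderiv ℝ (xStar Φ ex ey t y) η))) η :=
    HasFDerivAt.comp η (g := D) hDd.hasFDerivAt hcurve
  have hsingle : ∀ (w : Coord d) (α : Fin d),
      ∑ β, w β * (EuclideanSpace.single α (1 : ℝ) : Coord d) β = w α := by
    intro w α
    simp
  -- Differentiability of `ξ*` is read off from that of `D` along the graph of `x*`.
  have hxi : ∀ α, HasFDerivAt (fun q => ((xiStar Φ ex ey t y q α : ℝ) : ℂ)) _ η := fun α =>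
    ((ContinuousLinearMap.apply ℝ ℂ (EuclideanSpace.single α (1 : ℝ) : Coord d)).hasFDerivAt.comp η
      hcomp).congr_of_eventuallyEq (by
        filter_upwards [hev] with q hq
        have := hq (EuclideanSpace.single α (1 : ℝ))
        rw [hsingle] at this
        exact this.symm)
  have hxid : ∀ α, DifferentiableAt ℝ (fun q => xiStar Φ ex ey t y q α) η := fun α =>
    (Complex.reCLM.hasFDerivAt.comp η (hxi α)).differentiableAt
  refine ⟨hxd, (differentiableAt_piLp 2).2 hxid, fun α β => ?_⟩
  set eα : Coord d := EuclideanSpace.single α (1 : ℝ) with heα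
  set eβ : Coord d := EuclideanSpace.single β (1 : ℝ) with heβ
  set w := fderiv ℝ (xStar Φ ex ey t y) η eβ with hw
  have h1 : ((pderiv (fun q => xiStar Φ ex ey t y q α) η β : ℝ) : ℂ) =
      fderiv ℝ D ((t, η), u₀) ((0, eβ), w) eα := by
    have h2 : HasFDerivAt (fun q => ((xiStar Φ ex ey t y q α : ℝ) : ℂ)) _ η :=
      Complex.ofRealCLM.hasFDerivAt.comp η (hxid α).hasFDerivAt
    exact DFunLike.congr_fun (h2.unique (hxi α)) eβ
  have h2 : mixedHessian φ ex ey t y u₀ η α β = fderiv ℝ D ((t, η), u₀) ((0, eβ), 0) eα := by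
    have h3 : HasFDerivAt (fun q => D ((t, q), u₀)) _ η :=
      HasFDerivAt.comp η (g := D) (f := fun q => ((t, q), u₀)) hDd.hasFDerivAt
        ((hasFDerivAt_prodMk_right t η).prodMk (hasFDerivAt_const u₀ η))
    have h4 := (ContinuousLinearMap.apply ℝ ℂ eα).hasFDerivAt.comp η h3
    exact DFunLike.congr_fun h4.fderiv eβ
  have h3 : fderiv ℝ D ((t, η), u₀) ((0, 0), w) eα =
      fderiv ℝ (fderiv ℝ (fun u => φ t (ex.symm u) p)) u₀ w eα :=
    (DFunLike.congr_fun (DFunLike.congr_fun (fderiv_right_eq_comp_inr hDd) w) eα).symm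
  -- The total derivative in `η_β` splits into the part with `x` frozen, which is `φ_xη`, and the
  -- part moving `x` along `w = ∂x*/∂η_β`, which is `φ_xx`.
  have h4 : fderiv ℝ D ((t, η), u₀) ((0, eβ), w) eα =
      fderiv ℝ D ((t, η), u₀) ((0, eβ), 0) eα + fderiv ℝ D ((t, η), u₀) ((0, 0), w) eα := by
    rw [← add_apply, ← map_add]
    simp
  have hwν : ∀ ν, pderiv (fun q => xStar Φ ex ey t y q ν) η β = w ν := fun ν =>
    DFunLike.congr_fun ((EuclideanSpace.proj (𝕜 := ℝ) ν : Coord d →L[ℝ] ℝ).hasFDerivAt.comp η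
      hxd.hasFDerivAt).fderiv eβ
  rw [h1, h2, h4, h3, hu₀, xStar, hφ.fderiv_fderiv_xStar hex t hp0 hx]
  simp_rw [hwν]
  have h5 : ∀ S : Fin d → Fin d → ℂ, ∑ σ, ∑ ν, S σ ν * (w σ : ℂ) * (eα ν : ℂ) =
      ∑ σ, S σ α * (w σ : ℂ) := by
    intro S
    refine Finset.sum_congr rfl fun σ _ => ?_
    rw [Finset.sum_eq_single α]
    · simp [heα]
    · intro ν _ hν
      simp [heα, hν]
    · simp
  rw [h5]
  have h6 : ∑ μ, ∑ ν, christoffel ex (Φ t p).1 μ α ν * xiStar Φ ex ey t y η μ * w ν =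
      ∑ σ, (∑ μ, christoffel ex (Φ t p).1 μ σ α * components ex (Φ t p) μ) * w σ := by
    rw [Finset.sum_comm]
    refine Finset.sum_congr rfl fun σ _ => ?_
    rw [Finset.sum_mul]
    refine Finset.sum_congr rfl fun μ _ => ?_
    rw [christoffel_comm]
    rfl
  rw [h6]
  simp_rw [metricMatrix_comm _ α]
  simp only [add_mul, Finset.sum_add_distrib, Complex.ofReal_sum, Complex.ofReal_mul,
    Finset.mul_sum, mul_assoc]
  ring
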